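/- **Notation.** Let $K$ be a field with $2\ne 0$ and let $q\in K$, $q\neq 0$, be such that $[k]_{q^2}\ne 0$ for all $k\ge 1$, where $[k]_q=1+q+\cdots+q^{k-1}$ and $[k]_q!=[1]_q[2]_q\cdots[k]_q$. (For example, $q$ is an indeterminate over $\mathbb Q$ and $K=\mathbb Q(q)$, or $q$ is a nonzero real number.) On the triangular lattice with horizontal lattice lines use coordinates $(i,j)$, the $i$-axis along a horizontal lattice line with unit half the edge length, the $j$-axis perpendicular to it through a lattice point with unit the height of a unit triangle. A lozenge is the union of two unit triangles that share an edge. Under the symmetric weight $\operatorname{wt}_1$, a vertical lozenge (one whose two triangles share a horizontal edge) with center $(i,j)$ has weight $\frac{q^i+q^{-i}}2$, and every other lozenge has weight $1$. For a region $R$ (a finite set of unit triangles), $\operatorname{M}(R)$ is the sum, over all tilings of $R$ by lozenges, of the product of the weights of the lozenges in the tiling (so $\operatorname{M}(\emptyset)=1$). **The region.** Let $x,d,m$ be non-negative integers with $m\le d$ and let $1\le l_1<l_2<\cdots<l_m\le d$ be integers. Take the halved hexagon whose north, northeast, southeast and south sides have lengths $x$, $2d-m$, $m$, $x+d-m$,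 and whose west side is a vertical zigzag with $2d$ unit steps which, from bottom to top, go alternately up-left and up-right. The zigzag has $d$ bumps (corners pointing west), labelled $1,\dots,d$ from bottom to top; the $j$-axis passes through the tips of the bumps. Remove from the halved hexagon the $d-m$ up-pointing unit triangles at the tips of the bumps whose labels are not among $l_1,\dots,l_m$. Let $A_{x,d}(l_1,\dots,l_m)$ be the resulting region, with lozenge weights $\operatorname{wt}_1$. **The product.** For non-negative integers $x,\ m\le d,\ n\le u$ and integers $1\le l_1<\dots<l_m\le d$, $1\le h_1<\dots<h_n\le u$, put $e=\min(u-n,d-m)$, $\overline x=x+\max(u-n,d-m)$, $t_1=2(x+u-n-e)+1$, $t_2=2(x+d-m-e)$, $f(t,a,b)=\frac{ab(2t+a-b)}2$, $\left\langle{b\atop a}\right\rangle=a+(a+1)+\cdots+b$ for $0\le a\le b$, $$E=f(t_1+2d-m,n,m+1)+\sum_{i=1}^m\left\langle{t_1+2d-m-(m-i+1)\atop t_1+2(d-l_i)-2(m-i)}\right\rangle+\sum_{i=1}^n\left\langle{t_2+2u-n-(n-i+1)\atop t_2+2(u-h_i)-2(n-i)}\right\rangle,$$ $$F=n(m+1)+\sum_{i=1}^m(2l_i-i)+\sum_{i=1}^n(2h_i-i),$$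 and $$\begin{aligned}P(x,u,d,(l_i)_{i=1}^m,(h_j)_{j=1}^n)={}&2^{-F}q^{-E}\,\frac{\prod_{1\le i<j\le m}[2(l_j-l_i)]_{q^2}\prod_{1\le i<j\le n}[2(h_j-h_i)]_{q^2}}{\prod_{i=1}^m\prod_{j=1}^n[2(l_i+h_j)]_{q^2}\prod_{i=1}^m[2l_i-1]_{q^2}!\prod_{j=1}^n[2h_j]_{q^2}!}\\ &\times\prod_{i=1}^{\lceil m/2\rceil}\prod_{j=1}^{2m-4i+3}[2\overline x+2i+j-1]_{q^2}\\ &\times\prod_{i=1}^n[2(\overline x+m+i)]_{q^2}\prod_{i=1}^n\prod_{j=1}^{m+i}[2\overline x+m+i+j]_{q^2}\\ &\times\prod_{i=1}^m\prod_{j=1}^n\frac{[2(\overline x+i+j-1)]_{q^2}}{[2(\overline x+i+j-1)+1]_{q^2}}\\ &\times\prod_{i=1}^m\prod_{j=1}^{l_i-i}[2(\overline x+i+j+n)]_{q^2}[2(\overline x-i-j+m+1)]_{q^2}\\ &\times\prod_{i=1}^n\prod_{j=1}^{h_i-i}[2(\overline x+i+j+m)]_{q^2}[2(\overline x-i-j+n+1)]_{q^2}.\end{aligned}$$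 **Theorem (Formula for a region of type A).** For all non-negative integers $x,d,m$ with $m\le d$ and all integers $1\le l_1<\cdots<l_m\le d$, $$\operatorname{M}(A_{x,d}(l_1,\dots,l_m))=P(x,0,d,(l_i)_{i=1}^m,\emptyset),$$ that is, with $\overline x=x+d-m$, $F=\sum_{i=1}^m(2l_i-i)$ and $E=\sum_{i=1}^m\left\langle{2x+2d-2m+i\atop 2x+2d+1-2l_i-2m+2i}\right\rangle$, $$\operatorname{M}(A_{x,d}(l_1,\dots,l_m))=2^{-F}q^{-E}\,\frac{\prod_{1\le i<j\le m}[2(l_j-l_i)]_{q^2}}{\prod_{i=1}^m[2l_i-1]_{q^2}!}\prod_{i=1}^{\lceil m/2\rceil}\prod_{j=1}^{2m-4i+3}[2\overline x+2i+j-1]_{q^2}\prod_{i=1}^m\prod_{j=1}^{l_i-i}[2(\overline x+i+j)]_{q^2}[2(\overline x-i-j+m+1)]_{q^2}.$$ -/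

import Mathlib

namespace HalvedHexagon

open Finset

/-- Unit triangles of the triangular lattice. Cartesian units: half an edge length horizontally
(the `i`-axis) and the height of a unit triangle vertically (the `j`-axis); the lattice vertices
are then the integer points `(a, b)` with `a + b` even, and the origin is one of them.
The pair `(i, j)` stands for the unit triangle lying between the horizontal lines at heights
`j` and `j + 1` whose apex and base midpoint both have abscissa `i`. -/
abbrev Triangle := ℤ × ℤ

/-- Up-pointing unit triangles: vertices `(i - 1, j)`, `(i + 1, j)`, `(i, j + 1)`. -/
def IsUp (t : Triangle) : Prop := Odd (t.1 + t.2)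

/-- Down-pointing unit triangles: vertices `(i - 1, j + 1)`, `(i + 1, j + 1)`, `(i, j)`. -/
def IsDown (t : Triangle) : Prop := Even (t.1 + t.2)

instance : DecidablePred IsUp := fun t => inferInstanceAs (Decidable (Odd (t.1 + t.2)))
instance : DecidablePred IsDown := fun t => inferInstanceAs (Decidable (Even (t.1 + t.2)))

/-- The pair `(s, t)` is the lozenge made of the up-pointing unit triangle `s` and the
down-pointing unit triangle `t`, which share an edge: either they are neighbours in the same row,
or `t` lies directly below the horizontal edge of `s` (a vertical lozenge). -/
def IsLozenge (L : Triangle × Triangle) : Prop :=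
  IsUp L.1 ∧ IsDown L.2 ∧
    ((L.1.2 = L.2.2 ∧ |L.1.1 - L.2.1| = 1) ∨ (L.1.1 = L.2.1 ∧ L.1.2 = L.2.2 + 1))

instance : DecidablePred IsLozenge := fun L => by unfold IsLozenge; infer_instance

/-- The lozenge tilings of a finite region (a finite set of unit triangles): sets of lozenges
contained in the region such that each unit triangle of the region lies in exactly one of them. -/
def tilings (R : Finset Triangle) : Finset (Finset (Triangle × Triangle)) :=
  ((R ×ˢ R).filter IsLozenge).powerset.filter fun T =>
    ∀ t ∈ R, (T.filter fun L => L.1 = t ∨ L.2 = t).card = 1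

/-- The symmetric weight of a lozenge: a vertical lozenge whose center has abscissa `i` has weight
`(q ^ i + q ^ (-i)) / 2`; every other lozenge has weight `1`. The two triangles of a lozenge have
the same abscissa exactly when the lozenge is vertical, and then the midpoint of their common
edge, i.e. the center, has this abscissa. -/
def wt1 {K : Type*} [Field K] (q : K) (L : Triangle × Triangle) : K :=
  if L.1.1 = L.2.1 then (q ^ L.1.1 + q ^ (-L.1.1)) / 2 else 1

/-- The tiling generating function of the region `R` with lozenge weight `wt`. -/
def tgf {K : Type*} [Field K] (wt : Triangle × Triangle → K) (R : Finset Triangle) : K :=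
  ∑ T ∈ tilings R, ∏ L ∈ T, wt L

/-- The halved hexagon with north, northeast, southeast and south sides of lengths
`x`, `2d - m`, `m`, `x + d - m`, whose west side is a vertical zigzag with `2d` unit steps going
alternately up-left and up-right from the southwest corner `(1, -1)` to the northwest corner
`(1, 2d - 1)`. The westernmost lattice points of the zigzag, the tips of the `d` bumps, are
`(0, 0), (0, 2), …, (0, 2d - 2)`; so the `j`-axis is tangent to the west side.
The unit triangle `(i, j)` belongs to the region iff it is in one of the `2d` rows, to the right
of the `j`-axis, on the left of the line `a + b = 2(x + d)` carrying the northeast side, and on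
the left of the line `a - b = 2(x + d - m) + 2` carrying the southeast side. -/
noncomputable def halvedHexagon (x d m : ℕ) : Finset Triangle :=
  (Icc (1 : ℤ) (2 * (x + d)) ×ˢ Icc (-1 : ℤ) (2 * d - 2)).filter fun t =>
    t.1 + t.2 + 1 ≤ 2 * ((x : ℤ) + d) ∧ t.1 - t.2 ≤ 2 * ((x : ℤ) + d - m) + 2

/-- The up-pointing unit triangle of the `k`-th bump of the west side (counted from the bottom,
starting with `k = 1`); its vertices are the tip `(0, 2k - 2)` and `(2, 2k - 2)`, `(1, 2k - 1)`. -/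
def bump (k : ℕ) : Triangle := (1, 2 * (k : ℤ) - 2)

/-- The shape of the region `A_{x,d}(l_1, …, l_m)`: the up-pointing unit triangles of all bumps
except those at the positions `l_1, …, l_m` are removed from the halved hexagon. -/
noncomputable def regionA (x d m : ℕ) (l : ℕ → ℕ) : Finset Triangle :=
  halvedHexagon x d m \ ((Icc 1 d \ (Icc 1 m).image l).image bump)

/-- The `q`-integer `[n]_q = 1 + q + ⋯ + q ^ (n - 1)`. -/
def qInt {K : Type*} [Field K] (q : K) (n : ℕ) : K := ∑ k ∈ range n, q ^ k

/-- The `q`-factorial `[n]_q! = [1]_q [2]_q ⋯ [n]_q`. -/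
def qFact {K : Type*} [Field K] (q : K) (n : ℕ) : K := ∏ k ∈ Icc 1 n, qInt q k

/-- `⟨b; a⟩ = a + (a + 1) + ⋯ + b` for `0 ≤ a ≤ b`. -/
noncomputable def angle (b a : ℤ) : ℤ := ∑ k ∈ Icc a b, k

/-- `f(t, x, y) = xy(2t + x - y) / 2`; the division is exact, as `xy(x - y)` is even. -/
def auxf (t x y : ℤ) : ℤ := x * y * (2 * t + x - y) / 2

/-- The number `e = min(u - n, d - m)`. -/
def eParam (u d m n : ℕ) : ℤ := min ((u : ℤ) - n) ((d : ℤ) - m)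

/-- The number `t₁ = 2(x + u - n - e) + 1`. -/
def t1Param (x u d m n : ℕ) : ℤ := 2 * ((x : ℤ) + u - n - eParam u d m n) + 1

/-- The number `t₂ = 2(x + d - m - e)`. -/
def t2Param (x u d m n : ℕ) : ℤ := 2 * ((x : ℤ) + d - m - eParam u d m n)

/-- The exponent `E(x, u, d, l, h)`. -/
noncomputable def expE (x u d m n : ℕ) (l h : ℕ → ℕ) : ℤ :=
  auxf (t1Param x u d m n + 2 * d - m) n (m + 1)
    + ∑ i ∈ Icc 1 m,
        angle (t1Param x u d m n + 2 * d - m - ((m : ℤ) - i + 1))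
          (t1Param x u d m n + 2 * ((d : ℤ) - l i) - 2 * ((m : ℤ) - i))
    + ∑ i ∈ Icc 1 n,
        angle (t2Param x u d m n + 2 * u - n - ((n : ℤ) - i + 1))
          (t2Param x u d m n + 2 * ((u : ℤ) - h i) - 2 * ((n : ℤ) - i))

/-- The exponent `F(l, h)`. -/
def expF (m n : ℕ) (l h : ℕ → ℕ) : ℤ :=
  (n : ℤ) * (m + 1) + ∑ i ∈ Icc 1 m, (2 * (l i : ℤ) - i) + ∑ i ∈ Icc 1 n, (2 * (h i : ℤ) - i)

/-- The number `x̄ = x + max(u - n, d - m)`, for `n ≤ u` and `m ≤ d`. -/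
def xBar (x u d m n : ℕ) : ℕ := x + max (u - n) (d - m)

/-- The product `P(x, u, d, (l_i)_{i=1}^m, (h_j)_{j=1}^n)`, meant for `m ≤ d`, `n ≤ u` and
strictly increasing sequences `1 ≤ l_1 < ⋯ < l_m ≤ d`, `1 ≤ h_1 < ⋯ < h_n ≤ u`; for these no
subtraction of natural numbers below is truncated. Only `l 1, …, l m` and `h 1, …, h n` matter. -/
noncomputable def P {K : Type*} [Field K] (q : K) (x u d m n : ℕ) (l h : ℕ → ℕ) : K :=
  (2 : K) ^ (-expF m n l h) * q ^ (-expE x u d m n l h)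
    * (((∏ i ∈ Icc 1 m, ∏ j ∈ Icc (i + 1) m, qInt (q ^ 2) (2 * (l j - l i)))
          * ∏ i ∈ Icc 1 n, ∏ j ∈ Icc (i + 1) n, qInt (q ^ 2) (2 * (h j - h i)))
        / ((∏ i ∈ Icc 1 m, ∏ j ∈ Icc 1 n, qInt (q ^ 2) (2 * (l i + h j)))
          * (∏ i ∈ Icc 1 m, qFact (q ^ 2) (2 * l i - 1))
          * ∏ j ∈ Icc 1 n, qFact (q ^ 2) (2 * h j)))
    * (∏ i ∈ Icc 1 ((m + 1) / 2), ∏ j ∈ Icc 1 (2 * m + 3 - 4 * i),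
        qInt (q ^ 2) (2 * xBar x u d m n + 2 * i + j - 1))
    * (∏ i ∈ Icc 1 n, qInt (q ^ 2) (2 * (xBar x u d m n + m + i)))
    * (∏ i ∈ Icc 1 n, ∏ j ∈ Icc 1 (m + i), qInt (q ^ 2) (2 * xBar x u d m n + m + i + j))
    * (∏ i ∈ Icc 1 m, ∏ j ∈ Icc 1 n,
        qInt (q ^ 2) (2 * (xBar x u d m n + i + j - 1))
          / qInt (q ^ 2) (2 * (xBar x u d m n + i + j - 1) + 1))
    * (∏ i ∈ Icc 1 m, ∏ j ∈ Icc 1 (l i - i),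
        qInt (q ^ 2) (2 * (xBar x u d m n + i + j + n))
          * qInt (q ^ 2) (2 * (xBar x u d m n + m + 1 - i - j)))
    * (∏ i ∈ Icc 1 n, ∏ j ∈ Icc 1 (h i - i),
        qInt (q ^ 2) (2 * (xBar x u d m n + i + j + m))
          * qInt (q ^ 2) (2 * (xBar x u d m n + n + 1 - i - j)))

end HalvedHexagon

/-! A tiling is a family of non-intersecting paths of lozenges, one ending at each of the bumps
`l_1, …, l_m`. The lines parallel to the southeast side sweep over the region, and the determinant
of the generating functions of the paths from a line to the bumps obeys the same recursion as the
sum over the tilings of the part of the region that a line cuts off, in the manner of Lindström,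
Gessel and Viennot. For the weight `wt1` the generating function of a single path is a product of
symmetric `q`-integers. Up to factors of its rows and columns, the entries of the matrix are
therefore products of forms `[n - b]`, which are linear in the pair `([n - 1], [n])`, and the
determinant is a Vandermonde product. Writing the ordinary `q`-integers in `P` through symmetric
ones cancels the power of `q` in front of `P`. -/

namespace HalvedHexagon

open Finset

section Tilings

variable {R : Finset Triangle} {T : Finset (Triangle × Triangle)} {L : Triangle × Triangle}

theorem mem_tilings :
    T ∈ tilings R ↔ (∀ L ∈ T, L.1 ∈ R ∧ L.2 ∈ R ∧ IsLozenge L) ∧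
      ∀ t ∈ R, ∃! L, L ∈ T ∧ (L.1 = t ∨ L.2 = t) := by
  simp only [tilings, mem_filter, mem_powerset, subset_iff, mem_product, and_assoc,
    card_eq_one, Finset.ext_iff, mem_singleton, ExistsUnique]
  refine and_congr_right fun _ => forall₂_congr fun t _ => exists_congr fun L => ?_
  grind

theorem tilings_empty : tilings ∅ = {∅} := by
  ext T
  simp [mem_tilings, eq_empty_iff_forall_notMem]

theorem not_isUp_iff_isDown {t : Triangle} : ¬IsUp t ↔ IsDown t := Int.not_odd_iff_even

theorem not_isDown_iff_isUp {t : Triangle} : ¬IsDown t ↔ IsUp t := Int.not_even_iff_odd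

theorem erase_mem_tilings (hT : T ∈ tilings R) (hL : L ∈ T) :
    T.erase L ∈ tilings (R \ {L.1, L.2}) := by
  rw [mem_tilings] at hT ⊢
  obtain ⟨hmem, hcover⟩ := hT
  simp only [mem_sdiff, mem_insert, mem_singleton, mem_erase]
  refine ⟨fun L' hL' => ?_, fun t ht => ?_⟩
  · have hdisj : ∀ t ∈ R, (L.1 = t ∨ L.2 = t) → ¬(L'.1 = t ∨ L'.2 = t) := fun t ht h h' =>
      hL'.1 ((hcover t ht).unique ⟨hL'.2, h'⟩ ⟨hL, h⟩)
    have h₁ := hdisj L.1 (hmem L hL).1 (Or.inl rfl)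
    have h₂ := hdisj L.2 (hmem L hL).2.1 (Or.inr rfl)
    have := hmem L' hL'.2
    tauto
  · obtain ⟨L', hL', huniq⟩ := hcover t ht.1
    refine ⟨L', ⟨⟨?_, hL'.1⟩, hL'.2⟩, fun L'' h => huniq L'' ⟨h.1.2, h.2⟩⟩
    rintro rfl
    exact ht.2 (hL'.2.imp Eq.symm Eq.symm)

theorem notMem_of_mem_tilings_sdiff (hT : T ∈ tilings (R \ {L.1, L.2})) : L ∉ T := fun h => by
  simpa using ((mem_tilings.1 hT).1 L h).1

theorem insert_mem_tilings (hL : IsLozenge L) (hL₁ : L.1 ∈ R) (hL₂ : L.2 ∈ R)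
    (hT : T ∈ tilings (R \ {L.1, L.2})) : insert L T ∈ tilings R := by
  rw [mem_tilings] at hT ⊢
  obtain ⟨hmem, hcover⟩ := hT
  simp only [mem_sdiff, mem_insert, mem_singleton, not_or] at hmem hcover ⊢
  refine ⟨?_, fun t ht => ?_⟩
  · rintro L' (rfl | h)
    · exact ⟨hL₁, hL₂, hL⟩
    · exact ⟨(hmem L' h).1.1, (hmem L' h).2.1.1, (hmem L' h).2.2⟩
  · by_cases hLt : L.1 = t ∨ L.2 = t
    · refine ⟨L, ⟨Or.inl rfl, hLt⟩, ?_⟩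
      rintro L' ⟨rfl | h, hL't⟩
      · rfl
      · have := hmem L' h
        rcases hLt with rfl | rfl <;> rcases hL't with e | e <;> simp [e] at this
    · push Not at hLt
      obtain ⟨L', hL', huniq⟩ := hcover t ⟨ht, hLt.1.symm, hLt.2.symm⟩
      refine ⟨L', ⟨Or.inr hL'.1, hL'.2⟩, ?_⟩
      rintro L'' ⟨rfl | h, hL''t⟩
      · tauto
      · exact huniq L'' ⟨h, hL''t⟩

variable {K : Type*} [Field K] (wt : Triangle × Triangle → K)

@[simp]
theorem tgf_empty : tgf wt ∅ = 1 := by simp [tgf, tilings_empty]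

theorem sum_tilings_of_mem (hL : IsLozenge L) (hL₁ : L.1 ∈ R) (hL₂ : L.2 ∈ R) :
    ∑ T ∈ tilings R with L ∈ T, ∏ L' ∈ T, wt L' = wt L * tgf wt (R \ {L.1, L.2}) := by
  rw [tgf, mul_sum]
  refine sum_bij' (fun T _ => T.erase L) (fun T _ => insert L T)
    (fun T hT => ?_) (fun T hT => ?_) (fun T hT => ?_) (fun T hT => ?_) (fun T hT => ?_)
  · exact erase_mem_tilings (mem_filter.1 hT).1 (mem_filter.1 hT).2
  · exact mem_filter.2 ⟨insert_mem_tilings hL hL₁ hL₂ hT, mem_insert_self _ _⟩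
  · exact insert_erase (mem_filter.1 hT).2
  · exact erase_insert (notMem_of_mem_tilings_sdiff hT)
  · exact (mul_prod_erase T wt (mem_filter.1 hT).2).symm

theorem tgf_eq_sum_lozenges {t : Triangle} (ht : t ∈ R) :
    tgf wt R = ∑ L ∈ R ×ˢ R with IsLozenge L ∧ (L.1 = t ∨ L.2 = t),
      wt L * tgf wt (R \ {L.1, L.2}) := by
  set S := (R ×ˢ R).filter fun L => IsLozenge L ∧ (L.1 = t ∨ L.2 = t)
  calc tgf wt R = ∑ T ∈ tilings R, ∑ L ∈ S, if L ∈ T then ∏ L' ∈ T, wt L' else 0 := by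
        refine sum_congr rfl fun T hT => ?_
        obtain ⟨hmem, hcover⟩ := mem_tilings.1 hT
        obtain ⟨L, ⟨hLT, hLt⟩, huniq⟩ := hcover t ht
        have hLS : L ∈ S := by simp [S, hmem L hLT, hLt]
        rw [sum_eq_single_of_mem L hLS, if_pos hLT]
        exact fun L' hL' hne => if_neg fun h => hne (huniq L' ⟨h, (mem_filter.1 hL').2.2⟩)
    _ = ∑ L ∈ S, wt L * tgf wt (R \ {L.1, L.2}) := by
        rw [sum_comm]
        refine sum_congr rfl fun L hL => ?_
        simp only [S, mem_filter, mem_product] at hL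
        rw [← sum_filter, sum_tilings_of_mem wt hL.2.1 hL.1.1 hL.1.2]

theorem tgf_eq_sum_of_isDown {t : Triangle} (ht : t ∈ R) (hd : IsDown t) :
    tgf wt R = ∑ s ∈ R with IsLozenge (s, t), wt (s, t) * tgf wt (R \ {s, t}) := by
  rw [tgf_eq_sum_lozenges wt ht]
  refine sum_nbij' Prod.fst (·, t) ?_ ?_ ?_ ?_ ?_
  all_goals simp only [mem_filter, mem_product, and_imp, Prod.forall, ← not_isUp_iff_isDown] at *
  all_goals grind [IsLozenge]

theorem tgf_eq_sum_of_isUp {s : Triangle} (hs : s ∈ R) (hu : IsUp s) :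
    tgf wt R = ∑ t ∈ R with IsLozenge (s, t), wt (s, t) * tgf wt (R \ {s, t}) := by
  rw [tgf_eq_sum_lozenges wt hs]
  refine sum_nbij' Prod.snd (s, ·) ?_ ?_ ?_ ?_ ?_
  all_goals simp only [mem_filter, mem_product, and_imp, Prod.forall, ← not_isDown_iff_isUp] at *
  all_goals grind [IsLozenge]

theorem isLozenge_iff_of_isDown {s : Triangle} {i j : ℤ} (hd : IsDown (i, j)) :
    IsLozenge (s, (i, j)) ↔ s = (i - 1, j) ∨ s = (i + 1, j) ∨ s = (i, j + 1) := by
  obtain ⟨a, b⟩ := s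
  grind [IsLozenge, IsUp, IsDown]

theorem isLozenge_iff_of_isUp {t : Triangle} {i j : ℤ} (hu : IsUp (i, j)) :
    IsLozenge ((i, j), t) ↔ t = (i - 1, j) ∨ t = (i + 1, j) ∨ t = (i, j - 1) := by
  obtain ⟨a, b⟩ := t
  grind [IsLozenge, IsUp, IsDown]

theorem tgf_of_isDown {i j : ℤ} (ht : (i, j) ∈ R) (hd : IsDown (i, j)) (hright : (i + 1, j) ∉ R) :
    tgf wt R =
      (if (i - 1, j) ∈ R then
        wt ((i - 1, j), (i, j)) * tgf wt (R \ {(i - 1, j), (i, j)}) else 0) +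
      if (i, j + 1) ∈ R then
        wt ((i, j + 1), (i, j)) * tgf wt (R \ {(i, j + 1), (i, j)}) else 0 := by
  have hfilter : R.filter (fun s => IsLozenge (s, (i, j))) =
      ({(i - 1, j), (i, j + 1)} : Finset Triangle).filter (· ∈ R) := by
    ext s
    simp only [mem_filter, mem_insert, mem_singleton, isLozenge_iff_of_isDown hd]
    grind
  rw [tgf_eq_sum_of_isDown wt ht hd, hfilter, sum_filter, sum_pair (by simp)]

theorem tgf_of_isUp {i j : ℤ} (ht : (i, j) ∈ R) (hu : IsUp (i, j)) (hright : (i + 1, j) ∉ R)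
    (hbelow : (i, j - 1) ∉ R) :
    tgf wt R = if (i - 1, j) ∈ R then
      wt ((i, j), (i - 1, j)) * tgf wt (R \ {(i, j), (i - 1, j)}) else 0 := by
  have hfilter : R.filter (fun t => IsLozenge ((i, j), t)) =
      ({(i - 1, j)} : Finset Triangle).filter (· ∈ R) := by
    ext t
    simp only [mem_filter, mem_singleton, isLozenge_iff_of_isUp hu]
    grind
  rw [tgf_eq_sum_of_isUp wt ht hu, hfilter, sum_filter, sum_singleton]

theorem tgf_eq_prod_forced_mul (U R : Finset Triangle)
    (hU : ∀ u ∈ U, u ∈ R ∧ IsUp u ∧ (u.1 + 1, u.2) ∉ R ∧ (u.1, u.2 - 1) ∉ R ∧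
      (u.1 - 1, u.2) ∈ R) :
    tgf wt R = (∏ u ∈ U, wt (u, (u.1 - 1, u.2))) *
      tgf wt (R \ (U ∪ U.image fun u => (u.1 - 1, u.2))) := by
  induction U using Finset.induction_on generalizing R with
  | empty => simp
  | insert u U hu ih =>
    obtain ⟨huR, hup, hright, hbelow, hleft⟩ := hU u (mem_insert_self _ _)
    have hsdiff : (R \ {u, (u.1 - 1, u.2)}) \ (U ∪ U.image fun v => (v.1 - 1, v.2)) =
        R \ (insert u U ∪ (insert u U).image fun v => (v.1 - 1, v.2)) := by
      rw [sdiff_sdiff_left, image_insert]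
      congr 1
      grind
    rw [tgf_of_isUp wt huR hup hright hbelow, if_pos hleft, prod_insert hu, mul_assoc, ih, hsdiff]
    · intro v hv
      have := hU v (mem_insert_of_mem hv)
      grind [IsUp]

end Tilings

theorem mem_regionA {x d m : ℕ} {l : ℕ → ℕ} {i j : ℤ} :
    (i, j) ∈ regionA x d m l ↔ 1 ≤ i ∧ -1 ≤ j ∧ j ≤ 2 * d - 2 ∧ i + j + 1 ≤ 2 * ((x : ℤ) + d) ∧
      i - j ≤ 2 * ((x : ℤ) + d - m) + 2 ∧
      (i = 1 → Even j → ∃ r : Fin m, j = 2 * (l (r + 1) : ℤ) - 2) := by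
  simp only [regionA, halvedHexagon, bump, mem_sdiff, mem_filter, mem_product, mem_Icc, mem_image,
    Prod.mk.injEq]
  constructor
  · rintro ⟨⟨⟨⟨hi, hi'⟩, hj, hj'⟩, hne, hse⟩, hbump⟩
    refine ⟨hi, hj, hj', hne, hse, ?_⟩
    rintro rfl ⟨y, rfl⟩
    by_contra! hall
    refine hbump ⟨(y + 1).toNat, ⟨⟨by omega, by omega⟩, ?_⟩, rfl, by omega⟩
    rintro ⟨k, hk, hky⟩
    have := hall ⟨k - 1, by omega⟩
    simp only [Nat.sub_add_cancel hk.1] at this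
    omega
  · rintro ⟨hi, hj, hj', hne, hse, hbump⟩
    refine ⟨⟨⟨⟨hi, by omega⟩, hj, hj'⟩, hne, hse⟩, ?_⟩
    rintro ⟨k, ⟨_, hk'⟩, rfl, rfl⟩
    obtain ⟨r, hr⟩ := hbump rfl ⟨(k : ℤ) - 1, by ring⟩
    exact hk' ⟨r + 1, ⟨by omega, r.2⟩, by omega⟩

section Paths

variable {K : Type*} [Field K]

/-- The generating function of the paths of lozenges that start with the down-pointing unit triangle
`(i, j)` and end at the `k`-th bump. Each step pairs the down-pointing triangle with its left
neighbour or with the triangle above it, and leaves the lozenge through its left edge. A path that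
has reached the `j`-axis stops; it counts only if it has arrived at the tip of the bump. -/
noncomputable def pathGF (wt : Triangle × Triangle → K) (k : ℕ) (i j : ℤ) : K :=
  if i ≤ 0 then if j = 2 * k - 2 then 1 else 0
  else wt ((i - 1, j), (i, j)) * pathGF wt k (i - 2) j +
    wt ((i, j + 1), (i, j)) * pathGF wt k (i - 1) (j + 1)
termination_by i.toNat

variable (wt : Triangle × Triangle → K) {k : ℕ} {i j : ℤ}

theorem pathGF_of_nonpos (hi : i ≤ 0) : pathGF wt k i j = if j = 2 * k - 2 then 1 else 0 := by
  rw [pathGF, if_pos hi]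

theorem pathGF_of_pos (hi : 0 < i) :
    pathGF wt k i j = wt ((i - 1, j), (i, j)) * pathGF wt k (i - 2) j +
      wt ((i, j + 1), (i, j)) * pathGF wt k (i - 1) (j + 1) := by
  rw [pathGF, if_neg hi.not_ge]

theorem pathGF_of_lt (hj : 2 * (k : ℤ) - 2 < j) : pathGF wt k i j = 0 := by
  fun_induction pathGF wt k i j with
  | case1 => omega
  | case2 => rfl
  | case3 i j _ ih₁ ih₂ => rw [ih₁ hj, ih₂ (by omega), mul_zero, mul_zero, add_zero]

end Paths

section Slices

variable {m : ℕ}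

/-- The part of the region `R` still to be tiled when, in a sweep over the strips between the lines
`a - b = 2 * s` from the southeast to the northwest, the strip number `t` has been crossed by
the paths `r ≥ k` but not by the paths `r < k`, the path `r` being at height `p r`. -/
def sliceRegion (R : Finset Triangle) (p : Fin m → ℤ) (t : ℤ) (k : ℕ) : Finset Triangle :=
  R.filter fun u => u.1 - u.2 ≤ 2 * t - 2 ∨
    (u.1 - u.2 = 2 * t - 1 ∧ ∀ r : Fin m, k ≤ r → p r ≠ u.2) ∨
    (u.1 - u.2 = 2 * t ∧ ∃ r : Fin m, r < k ∧ p r = u.2)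

variable {R : Finset Triangle} {p : Fin m → ℤ} {t : ℤ}

theorem mem_sliceRegion {k : ℕ} {i j : ℤ} :
    (i, j) ∈ sliceRegion R p t k ↔ (i, j) ∈ R ∧ (i - j ≤ 2 * t - 2 ∨
      (i - j = 2 * t - 1 ∧ ∀ r : Fin m, k ≤ r → p r ≠ j) ∨
      (i - j = 2 * t ∧ ∃ r : Fin m, r < k ∧ p r = j)) := mem_filter

theorem sliceRegion_succ_of_nonpos (hR : ∀ u ∈ R, 1 ≤ u.1) {k : Fin m} (hk : 2 * t + p k ≤ 0) :
    sliceRegion R p t (k + 1) = sliceRegion R p t k := by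
  ext ⟨i, j⟩
  rw [mem_sliceRegion, mem_sliceRegion]
  grind

theorem sliceRegion_succ_sdiff_left (hp : p.Injective) (k : Fin m) :
    sliceRegion R p t (k + 1) \ {(2 * t + p k - 1, p k), (2 * t + p k, p k)} =
      sliceRegion R p t k := by
  ext ⟨i, j⟩
  have := @hp
  simp only [mem_sdiff, mem_sliceRegion, mem_insert, mem_singleton, Prod.mk.injEq]
  grind

theorem sliceRegion_succ_sdiff_above (hp : p.Injective) {k : Fin m} (hk : ∀ r, p r ≠ p k + 1) :
    sliceRegion R p t (k + 1) \ {(2 * t + p k, p k + 1), (2 * t + p k, p k)} =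
      sliceRegion R (Function.update p k (p k + 1)) t k := by
  ext ⟨i, j⟩
  have := @hp
  simp only [mem_sdiff, mem_sliceRegion, mem_insert, mem_singleton, Prod.mk.injEq,
    Function.update_apply]
  grind

theorem sliceRegion_zero_sdiff
    (hR : ∀ i j, i - j = 2 * t - 1 → (∀ r, p r ≠ j) → ((i, j) ∈ R ↔ (i - 1, j) ∈ R)) :
    sliceRegion R p t 0 \ ({u ∈ sliceRegion R p t 0 | u.1 - u.2 = 2 * t - 1} ∪
      {u ∈ sliceRegion R p t 0 | u.1 - u.2 = 2 * t - 1}.image fun u => (u.1 - 1, u.2)) =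
      sliceRegion R p (t - 1) m := by
  ext ⟨i, j⟩
  have := hR (i + 1) j
  simp only [mem_sdiff, mem_union, mem_filter, mem_image, mem_sliceRegion, Prod.exists,
    Prod.mk.injEq]
  grind

end Slices

section PathMatrix

variable {K : Type*} [Field K] {m : ℕ}

/-- The matrix of the generating functions of the paths that remain to be traced in
`sliceRegion R p t k`: the row `r` belongs to the path at height `p r`, the column `c` to the bump
`l (c + 1)`. -/
noncomputable def pathMatrix (wt : Triangle × Triangle → K) (l : ℕ → ℕ) (p : Fin m → ℤ) (t : ℤ)
    (k : ℕ) : Matrix (Fin m) (Fin m) K :=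
  Matrix.of fun r c => pathGF wt (l (c + 1)) (2 * (if r < k then t else t - 1) + p r) (p r)

variable (wt : Triangle × Triangle → K) (l : ℕ → ℕ) {p : Fin m → ℤ} {t : ℤ}

theorem pathMatrix_zero : pathMatrix wt l p t 0 = pathMatrix wt l p (t - 1) m := by
  ext r c
  simp [pathMatrix]

theorem pathMatrix_apply_of_lt {k : ℕ} {r : Fin m} (hr : r < k) :
    pathMatrix wt l p t k r = fun c : Fin m => pathGF wt (l (c + 1)) (2 * t + p r) (p r) := by
  ext c
  simp [pathMatrix, hr]

theorem pathMatrix_apply_of_le {k : ℕ} {r : Fin m} (hr : k ≤ r) :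
    pathMatrix wt l p t k r =
      fun c : Fin m => pathGF wt (l (c + 1)) (2 * (t - 1) + p r) (p r) := by
  ext c
  simp [pathMatrix, hr.not_gt]

theorem pathMatrix_succ (k : Fin m) :
    pathMatrix wt l p t (k + 1) = (pathMatrix wt l p t k).updateRow k
      fun c => pathGF wt (l (c + 1)) (2 * t + p k) (p k) := by
  ext r c
  rcases eq_or_ne r k with rfl | hrk
  · rw [Matrix.updateRow_self, pathMatrix_apply_of_lt wt l (Nat.lt_succ_self _)]
  · have hlt : (r : ℕ) < k + 1 ↔ (r : ℕ) < k := by omega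
    simp only [Matrix.updateRow_ne hrk, pathMatrix, Matrix.of_apply, hlt]

theorem pathMatrix_update (k : Fin m) (v : ℤ) :
    pathMatrix wt l (Function.update p k v) t k = (pathMatrix wt l p t k).updateRow k
      fun c => pathGF wt (l (c + 1)) (2 * (t - 1) + v) v := by
  ext r c
  rcases eq_or_ne r k with rfl | hrk
  · rw [Matrix.updateRow_self, pathMatrix_apply_of_le wt l le_rfl, Function.update_self]
  · simp only [Matrix.updateRow_ne hrk, pathMatrix, Matrix.of_apply, Function.update_of_ne hrk]

theorem pathMatrix_succ_of_nonpos {k : Fin m} (hk : 2 * t + p k ≤ 0) :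
    pathMatrix wt l p t (k + 1) = pathMatrix wt l p t k := by
  rw [pathMatrix_succ, ← Matrix.updateRow_eq_self (pathMatrix wt l p t k) k,
    Matrix.updateRow_idem, pathMatrix_apply_of_le wt l le_rfl]
  congr 1
  ext c
  rw [pathGF_of_nonpos wt hk, pathGF_of_nonpos wt (by omega)]

theorem det_pathMatrix_succ {k : Fin m} (hk : 0 < 2 * t + p k) :
    (pathMatrix wt l p t (k + 1)).det =
      wt ((2 * t + p k - 1, p k), (2 * t + p k, p k)) * (pathMatrix wt l p t k).det +
      wt ((2 * t + p k, p k + 1), (2 * t + p k, p k)) *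
        (pathMatrix wt l (Function.update p k (p k + 1)) t k).det := by
  have hrow : (fun c : Fin m => pathGF wt (l (c + 1)) (2 * t + p k) (p k)) =
      wt ((2 * t + p k - 1, p k), (2 * t + p k, p k)) • pathMatrix wt l p t k k +
        wt ((2 * t + p k, p k + 1), (2 * t + p k, p k)) •
          fun c : Fin m => pathGF wt (l (c + 1)) (2 * (t - 1) + (p k + 1)) (p k + 1) := by
    ext c
    rw [pathGF_of_pos wt hk, pathMatrix_apply_of_le wt l le_rfl]
    simp only [Pi.add_apply, Pi.smul_apply, smul_eq_mul]
    ring_nf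
  rw [pathMatrix_succ, hrow, Matrix.det_updateRow_add, Matrix.det_updateRow_smul,
    Matrix.det_updateRow_smul, Matrix.updateRow_eq_self, ← pathMatrix_update]

theorem det_pathMatrix_update_eq_zero {k r : Fin m} (hkr : k < r) (hr : p r = p k + 1) :
    (pathMatrix wt l (Function.update p k (p k + 1)) t k).det = 0 := by
  refine Matrix.det_zero_of_row_eq hkr.ne ?_
  rw [pathMatrix_apply_of_le wt l le_rfl, pathMatrix_apply_of_le wt l (by simpa using hkr.le),
    Function.update_self, Function.update_of_ne hkr.ne', hr]

end PathMatrix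

section Admissible

/-- The heights `p r` of the paths that can occur in the sweep through the region `A_{x,d}(l)` at
strip `t`, when the paths `r ≥ k` have crossed it: the paths are disjoint, they are inside the
region, and each bump that lies to the southeast of the strip has been reached. -/
structure Admissible (x d : ℕ) {m : ℕ} (l : ℕ → ℕ) (t : ℤ) (k : ℕ) (p : Fin m → ℤ) : Prop where
  strictMono : StrictMono p
  neg_one_le : ∀ r, -1 ≤ p r
  le_top : ∀ r, p r ≤ 2 * d - 2
  add_le : ∀ r, p r + t ≤ x + d
  add_lt : ∀ r : Fin m, r < k → p r + t < x + d
  reached : ∀ c : Fin m, 2 * t + 2 * (l (c + 1) : ℤ) - 2 ≤ 0 → ∃ r, p r = 2 * l (c + 1) - 2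

variable {x d m : ℕ} {l : ℕ → ℕ} {p : Fin m → ℤ} {t : ℤ}

theorem Admissible.of_succ {k : ℕ} (hp : Admissible x d l t (k + 1) p) :
    Admissible x d l t k p :=
  { hp with add_lt := fun r hr => hp.add_lt r (by omega) }

theorem Admissible.update {k : Fin m} (hp : Admissible x d l t (k + 1) p)
    (hk : ∀ r, p r ≠ p k + 1) (htop : p k + 1 ≤ 2 * d - 2) (hpos : 0 < 2 * t + p k) :
    Admissible x d l t k (Function.update p k (p k + 1)) where
  strictMono r s hrs := by
    have := hp.strictMono hrs
    simp only [Function.update_apply]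
    grind
  neg_one_le r := by
    have := hp.neg_one_le r
    simp only [Function.update_apply]
    grind
  le_top r := by
    have := hp.le_top r
    simp only [Function.update_apply]
    grind
  add_le r := by
    have := hp.add_le r
    have := hp.add_lt k (Nat.lt_succ_self _)
    simp only [Function.update_apply]
    grind
  add_lt r hr := by
    have := hp.add_lt r (by omega)
    simp only [Function.update_apply]
    grind
  reached c hc := by
    obtain ⟨r, hr⟩ := hp.reached c hc
    exact ⟨r, by rw [Function.update_of_ne (by rintro rfl; omega), hr]⟩

theorem Admissible.pred (hp : Admissible x d l t 0 p)
    (hreached : ∀ c : Fin m, 2 * (t - 1) + 2 * (l (c + 1) : ℤ) - 2 ≤ 0 →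
      ∃ r, p r = 2 * l (c + 1) - 2) :
    Admissible x d l (t - 1) m p where
  strictMono := hp.strictMono
  neg_one_le := hp.neg_one_le
  le_top := hp.le_top
  add_le r := by have := hp.add_le r; omega
  add_lt r _ := by have := hp.add_le r; omega
  reached := hreached

variable {K : Type*} [Field K] (wt : Triangle × Triangle → K)

theorem mem_regionA_iff_left_mem (ht : t ≤ x + d - m + 1)
    (hreached : ∀ c : Fin m, 2 * (t - 1) + 2 * (l (c + 1) : ℤ) - 2 ≤ 0 →
      ∃ r, p r = 2 * l (c + 1) - 2) {i j : ℤ} (hij : i - j = 2 * t - 1) (hpj : ∀ r, p r ≠ j) :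
    (i, j) ∈ regionA x d m l ↔ (i - 1, j) ∈ regionA x d m l := by
  rw [mem_regionA, mem_regionA]
  constructor
  · rintro ⟨hi, hj, hj', hne, hse, hbump⟩
    have : i ≠ 1 := by
      intro hi
      obtain ⟨c, hc⟩ := hbump hi ⟨1 - t, by omega⟩
      obtain ⟨r, hr⟩ := hreached c (by omega)
      exact hpj r (hr.trans hc.symm)
    grind
  · grind

theorem tgf_sliceRegion_zero (hwt : ∀ i j, wt ((i, j), (i - 1, j)) = 1)
    (ht : t ≤ x + d - m + 1)
    (hreached : ∀ c : Fin m, 2 * (t - 1) + 2 * (l (c + 1) : ℤ) - 2 ≤ 0 →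
      ∃ r, p r = 2 * l (c + 1) - 2) :
    tgf wt (sliceRegion (regionA x d m l) p t 0) =
      tgf wt (sliceRegion (regionA x d m l) p (t - 1) m) := by
  have hleft : ∀ i j, i - j = 2 * t - 1 → (∀ r, p r ≠ j) → _ := fun i j =>
    mem_regionA_iff_left_mem (x := x) (d := d) (l := l) (i := i) (j := j) ht hreached
  rw [← sliceRegion_zero_sdiff hleft, tgf_eq_prod_forced_mul wt
    {u ∈ sliceRegion (regionA x d m l) p t 0 | u.1 - u.2 = 2 * t - 1},
    prod_eq_one fun u _ => hwt u.1 u.2, one_mul]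
  rintro ⟨i, j⟩ hu
  obtain ⟨hu, hij⟩ := mem_filter.1 hu
  have := hleft i j
  simp only [mem_sliceRegion] at *
  grind [IsUp]

theorem tgf_sliceRegion_zero_eq_zero {c : Fin m} (hc : 2 * t + 2 * (l (c + 1) : ℤ) - 4 = 0)
    (hpc : ∀ r, p r ≠ 2 * l (c + 1) - 2)
    (hbump : (1, 2 * (l (c + 1) : ℤ) - 2) ∈ regionA x d m l) :
    tgf wt (sliceRegion (regionA x d m l) p t 0) = 0 := by
  have hmem : (1, 2 * (l (c + 1) : ℤ) - 2) ∈ sliceRegion (regionA x d m l) p t 0 :=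
    mem_sliceRegion.2 ⟨hbump, Or.inr (Or.inl ⟨by omega, fun r _ => hpc r⟩)⟩
  rw [tgf_of_isUp wt hmem ⟨l (c + 1) - 1, by dsimp only; ring⟩, if_neg]
  all_goals rw [mem_sliceRegion, mem_regionA]; grind

theorem det_pathMatrix_zero_eq_zero {c : Fin m} (hc : 2 * t + 2 * (l (c + 1) : ℤ) - 4 = 0)
    (hpc : ∀ r, p r ≠ 2 * l (c + 1) - 2) : (pathMatrix wt l p t 0).det = 0 := by
  refine Matrix.det_eq_zero_of_column_eq_zero c fun r => ?_
  rw [pathMatrix_apply_of_le wt l (Nat.zero_le _)]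
  rcases (hpc r).lt_or_gt with h | h
  · exact (pathGF_of_nonpos wt (by omega)).trans (if_neg (hpc r))
  · exact pathGF_of_lt wt h

theorem det_pathMatrix_eq_zero_of_left_notMem {k : Fin m} (hpos : 0 < 2 * t + p k)
    (hp : Admissible x d l t (k + 1) p) (ht : t ≤ x + d - m + 1)
    (hleft : (2 * t + p k - 1, p k) ∉ regionA x d m l) : (pathMatrix wt l p t k).det = 0 := by
  have := hp.neg_one_le k
  have := hp.le_top k
  have := hp.add_lt k (Nat.lt_succ_self _)
  refine Matrix.det_eq_zero_of_row_eq_zero k fun c => ?_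
  rw [mem_regionA] at hleft
  have hnonpos : 2 * (t - 1) + p k ≤ 0 := by grind
  rw [pathMatrix_apply_of_le wt l le_rfl]
  exact (pathGF_of_nonpos wt hnonpos).trans (if_neg (by grind))

theorem det_pathMatrix_update_eq_zero_of_above_notMem {k : Fin m} (hpos : 0 < 2 * t + p k)
    (hp : Admissible x d l t (k + 1) p) (ht : t ≤ x + d - m + 1)
    (hl : ∀ c : Fin m, l (c + 1) ≤ d)
    (habove : (2 * t + p k, p k + 1) ∉ regionA x d m l) :
    (pathMatrix wt l (Function.update p k (p k + 1)) t k).det = 0 := by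
  have := hp.neg_one_le k
  have := hp.add_lt k (Nat.lt_succ_self _)
  refine Matrix.det_eq_zero_of_row_eq_zero k fun c => ?_
  have := hl c
  rw [mem_regionA] at habove
  rw [pathMatrix_apply_of_le wt l le_rfl, Function.update_self]
  by_cases hc : 2 * (l (c + 1) : ℤ) - 2 < p k + 1
  · exact pathGF_of_lt wt hc
  · have hnonpos : 2 * (t - 1) + (p k + 1) ≤ 0 := by grind
    exact (pathGF_of_nonpos wt hnonpos).trans (if_neg (by grind))

end Admissible

section Sweep

variable {x d m : ℕ} {l : ℕ → ℕ} {p : Fin m → ℤ} {t : ℤ}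

theorem strictMono_comp_val_add_one (hl : StrictMonoOn l (Set.Icc 1 m)) :
    StrictMono fun r : Fin m => l (r + 1) :=
  fun _ _ hrs => hl ⟨by omega, by omega⟩ ⟨by omega, by omega⟩ (by simpa using hrs)

theorem Admissible.eq_of_one_sub (hp : Admissible x d l (1 - d) m p)
    (hl : StrictMono fun r : Fin m => l (r + 1)) (hld : ∀ c : Fin m, l (c + 1) ≤ d) :
    p = fun c : Fin m => 2 * (l (c + 1) : ℤ) - 2 := by
  have hbumps : StrictMono fun c : Fin m => 2 * (l (c + 1) : ℤ) - 2 := fun c c' hcc' => by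
    have := hl hcc'
    dsimp only at this ⊢
    omega
  choose f hf using fun c => hp.reached c (by have := hld c; omega)
  have hf_inj : f.Injective := fun c c' h => hbumps.injective (by simp only [← hf, h])
  refine (hp.strictMono.range_inj hbumps).1 ?_
  rw [← (Finite.surjective_of_injective hf_inj).range_comp p]
  exact congrArg Set.range (funext hf)

variable {K : Type*} [Field K] (wt : Triangle × Triangle → K)

theorem tgf_sliceRegion_one_sub (hp : Admissible x d l (1 - d) m p)
    (hl : StrictMono fun r : Fin m => l (r + 1)) (hld : ∀ c : Fin m, l (c + 1) ≤ d) :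
    tgf wt (sliceRegion (regionA x d m l) p (1 - d) m) = (pathMatrix wt l p (1 - d) m).det := by
  have hempty : sliceRegion (regionA x d m l) p (1 - d) m = ∅ := by
    refine eq_empty_of_forall_notMem fun ⟨i, j⟩ h => ?_
    rw [mem_sliceRegion, mem_regionA] at h
    omega
  have hone : pathMatrix wt l p (1 - d) m = 1 := by
    ext r c
    have := hp.le_top r
    rw [pathMatrix_apply_of_lt wt l r.2, Matrix.one_apply]
    refine (pathGF_of_nonpos wt (by omega)).trans (if_congr ?_ rfl rfl)
    rw [hp.eq_of_one_sub hl hld, ← hl.injective.eq_iff]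
    dsimp only
    omega
  rw [hempty, hone, tgf_empty, Matrix.det_one]

theorem tgf_sliceRegion_zero_eq_det (hwt : ∀ i j, wt ((i, j), (i - 1, j)) = 1)
    (hlb : ∀ c : Fin m, l (c + 1) ∈ Set.Icc 1 d) (ht : t ≤ x + d - m + 1)
    (hp : Admissible x d l t 0 p)
    (ih : Admissible x d l (t - 1) m p → tgf wt (sliceRegion (regionA x d m l) p (t - 1) m) =
      (pathMatrix wt l p (t - 1) m).det) :
    tgf wt (sliceRegion (regionA x d m l) p t 0) = (pathMatrix wt l p t 0).det := by
  by_cases hreached : ∀ c : Fin m, 2 * (t - 1) + 2 * (l (c + 1) : ℤ) - 2 ≤ 0 →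
      ∃ r, p r = 2 * l (c + 1) - 2
  · rw [tgf_sliceRegion_zero wt hwt ht hreached, pathMatrix_zero, ih (hp.pred hreached)]
  · push Not at hreached
    obtain ⟨c, hc, hpc⟩ := hreached
    have hc' : 2 * t + 2 * (l (c + 1) : ℤ) - 4 = 0 := by
      by_contra h
      obtain ⟨r, hr⟩ := hp.reached c (by omega)
      exact hpc r hr
    have := (hlb c).1
    have := (hlb c).2
    rw [tgf_sliceRegion_zero_eq_zero wt hc' hpc, det_pathMatrix_zero_eq_zero wt hc' hpc]
    exact mem_regionA.2 ⟨le_rfl, by omega, by omega, by omega, by omega, fun _ _ => ⟨c, rfl⟩⟩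

theorem head_mem_sliceRegion_succ {k : Fin m} (hp : Admissible x d l t (k + 1) p)
    (hpos : 0 < 2 * t + p k) (ht : t ≤ x + d - m + 1) :
    (2 * t + p k, p k) ∈ sliceRegion (regionA x d m l) p t (k + 1) := by
  have := hp.neg_one_le k
  have := hp.le_top k
  have := hp.add_lt k (Nat.lt_succ_self _)
  rw [mem_sliceRegion, mem_regionA]
  grind

theorem left_mem_sliceRegion_succ_iff {R : Finset Triangle} (hp : p.Injective) {k : Fin m} :
    (2 * t + p k - 1, p k) ∈ sliceRegion R p t (k + 1) ↔ (2 * t + p k - 1, p k) ∈ R := by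
  rw [mem_sliceRegion, and_iff_left]
  refine Or.inr (Or.inl ⟨by ring, fun r hr hrk => ?_⟩)
  rw [hp hrk] at hr
  omega

theorem above_mem_sliceRegion_succ_iff {R : Finset Triangle} (hp : StrictMono p) {k : Fin m} :
    (2 * t + p k, p k + 1) ∈ sliceRegion R p t (k + 1) ↔
      (2 * t + p k, p k + 1) ∈ R ∧ ∀ r, p r ≠ p k + 1 := by
  have hlt : ∀ r, p r = p k + 1 → k < r := fun r hr => hp.lt_iff_lt.1 (by omega)
  rw [mem_sliceRegion]
  grind

theorem tgf_sliceRegion_succ {k : Fin m} (hp : Admissible x d l t (k + 1) p)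
    (hpos : 0 < 2 * t + p k) (ht : t ≤ x + d - m + 1) :
    tgf wt (sliceRegion (regionA x d m l) p t (k + 1)) =
      (if (2 * t + p k - 1, p k) ∈ regionA x d m l then
        wt ((2 * t + p k - 1, p k), (2 * t + p k, p k)) *
          tgf wt (sliceRegion (regionA x d m l) p t k) else 0) +
      if (2 * t + p k, p k + 1) ∈ regionA x d m l ∧ ∀ r, p r ≠ p k + 1 then
        wt ((2 * t + p k, p k + 1), (2 * t + p k, p k)) *
          tgf wt (sliceRegion (regionA x d m l) (Function.update p k (p k + 1)) t k) else 0 := by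
  have hinj := hp.strictMono.injective
  have hright : (2 * t + p k + 1, p k) ∉ sliceRegion (regionA x d m l) p t (k + 1) := by
    rw [mem_sliceRegion]
    omega
  rw [tgf_of_isDown wt (head_mem_sliceRegion_succ hp hpos ht) ⟨t + p k, by dsimp only; ring⟩ hright,
    sliceRegion_succ_sdiff_left hinj]
  refine congrArg₂ _ (if_congr (left_mem_sliceRegion_succ_iff hinj) rfl rfl)
    (ite_congr (propext (above_mem_sliceRegion_succ_iff hp.strictMono)) (fun h => ?_) fun _ => rfl)
  rw [sliceRegion_succ_sdiff_above hinj h.2]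

theorem tgf_sliceRegion_succ_eq_det {k : Fin m} (hld : ∀ c : Fin m, l (c + 1) ≤ d)
    (ht : t ≤ x + d - m + 1)
    (ih : ∀ p : Fin m → ℤ, Admissible x d l t k p →
      tgf wt (sliceRegion (regionA x d m l) p t k) = (pathMatrix wt l p t k).det)
    (hp : Admissible x d l t (k + 1) p) :
    tgf wt (sliceRegion (regionA x d m l) p t (k + 1)) = (pathMatrix wt l p t (k + 1)).det := by
  rcases le_or_gt (2 * t + p k) 0 with hpos | hpos
  · rw [sliceRegion_succ_of_nonpos (fun u hu => (mem_regionA.1 hu).1) hpos,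
      pathMatrix_succ_of_nonpos wt l hpos, ih p hp.of_succ]
  rw [tgf_sliceRegion_succ wt hp hpos ht, det_pathMatrix_succ wt l hpos, ih p hp.of_succ]
  congr 1
  · split_ifs with hleft
    · rfl
    · rw [det_pathMatrix_eq_zero_of_left_notMem wt hpos hp ht hleft, mul_zero]
  · split_ifs with habove
    · have htop := (mem_regionA.1 habove.1).2.2.1
      rw [ih _ (hp.update habove.2 htop hpos)]
    · suffices (pathMatrix wt l (Function.update p k (p k + 1)) t k).det = 0 by
        rw [this, mul_zero]
      rw [not_and_or, not_forall_not] at habove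
      rcases habove with habove | ⟨r, hr⟩
      · exact det_pathMatrix_update_eq_zero_of_above_notMem wt hpos hp ht hld habove
      · exact det_pathMatrix_update_eq_zero wt l (hp.strictMono.lt_iff_lt.1 (by omega)) hr

theorem tgf_sliceRegion (hwt : ∀ i j, wt ((i, j), (i - 1, j)) = 1)
    (hl : StrictMono fun r : Fin m => l (r + 1)) (hlb : ∀ c : Fin m, l (c + 1) ∈ Set.Icc 1 d)
    (ht₀ : 1 - d ≤ t) (ht : t ≤ x + d - m + 1) (hp : Admissible x d l t m p) :
    tgf wt (sliceRegion (regionA x d m l) p t m) = (pathMatrix wt l p t m).det := by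
  induction t, ht₀ using Int.leInduction generalizing p with
  | base => exact tgf_sliceRegion_one_sub wt hp hl fun c => (hlb c).2
  | succ t _ ih =>
    suffices ∀ k ≤ m, ∀ p, Admissible x d l (t + 1) k p →
        tgf wt (sliceRegion (regionA x d m l) p (t + 1) k) = (pathMatrix wt l p (t + 1) k).det from
      this m le_rfl p hp
    intro k
    induction k with
    | zero =>
      exact fun _ p hp => tgf_sliceRegion_zero_eq_det wt hwt hlb ht hp
        (by rw [add_sub_cancel_right]; exact ih (by omega))
    | succ k ihk =>
      exact fun hk p hp => tgf_sliceRegion_succ_eq_det wt (k := ⟨k, hk⟩) (fun c => (hlb c).2) ht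
        (ihk (by omega)) hp

theorem sliceRegion_eq_self :
    sliceRegion (regionA x d m l) (fun r : Fin m => (r : ℤ) - 1) (x + d - m + 1) m =
      regionA x d m l := by
  refine filter_true_of_mem fun ⟨i, j⟩ hij => ?_
  obtain ⟨-, hj, -, hne, hse, -⟩ := mem_regionA.1 hij
  rcases lt_trichotomy (i - j) (2 * (x + d - m + 1) - 1) with h | h | h
  · left
    dsimp only
    omega
  · exact Or.inr (Or.inl ⟨h, fun r hr => absurd r.2 hr.not_gt⟩)
  · refine Or.inr (Or.inr ⟨by dsimp only; omega, ⟨(j + 1).toNat, by omega⟩, ?_, ?_⟩) <;>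
      dsimp only <;> omega

theorem admissible_initial (hmd : m ≤ d) (hlb : ∀ c : Fin m, 1 ≤ l (c + 1)) :
    Admissible x d l (x + d - m + 1) m fun r : Fin m => (r : ℤ) - 1 where
  strictMono r s hrs := by
    have : (r : ℕ) < s := hrs
    dsimp only
    omega
  neg_one_le r := by omega
  le_top r := by omega
  add_le r := by omega
  add_lt r _ := by omega
  reached c hc := by
    have := hlb c
    omega

theorem tgf_regionA_eq_det (hwt : ∀ i j, wt ((i, j), (i - 1, j)) = 1) (hmd : m ≤ d)
    (hl : StrictMonoOn l (Set.Icc 1 m)) (hlb : ∀ i ∈ Set.Icc 1 m, l i ∈ Set.Icc 1 d) :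
    tgf wt (regionA x d m l) = (Matrix.of fun r c : Fin m =>
      pathGF wt (l (c + 1)) (2 * (x + d - m + 1) + (r - 1)) (r - 1)).det := by
  have hlb' : ∀ c : Fin m, l (c + 1) ∈ Set.Icc 1 d := fun c => hlb _ ⟨by omega, by omega⟩
  rw [← sliceRegion_eq_self, tgf_sliceRegion wt hwt (strictMono_comp_val_add_one hl) hlb'
    (by omega) le_rfl (admissible_initial hmd fun c => (hlb' c).1)]
  congr 1
  ext r c
  rw [pathMatrix_apply_of_lt wt l r.2, Matrix.of_apply]

end Sweep

section SymmetricInteger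

open Polynomial.Chebyshev in
/-- The symmetric `q`-integer `(q ^ n - q ^ (-n)) / (q - q⁻¹)`. As a Chebyshev polynomial in
`q + q⁻¹` it makes sense for `q = ±1` too. -/
noncomputable def symInt {K : Type*} [Field K] (q : K) (n : ℤ) : K :=
  (S K (n - 1)).eval (q + q⁻¹)

variable {K : Type*} [Field K] {q : K}

@[simp] theorem symInt_zero (q : K) : symInt q 0 = 0 := by simp [symInt]

@[simp] theorem symInt_one (q : K) : symInt q 1 = 1 := by simp [symInt]

theorem symInt_add_one (q : K) (n : ℤ) :
    symInt q (n + 1) = (q + q⁻¹) * symInt q n - symInt q (n - 1) := by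
  simpa [symInt] using
    congrArg (Polynomial.eval (q + q⁻¹)) (Polynomial.Chebyshev.S_add_one K (n - 1))

theorem symInt_neg (q : K) (n : ℤ) : symInt q (-n) = -symInt q n := by
  simp [symInt, Polynomial.Chebyshev.S_neg_sub_one]

theorem symInt_sub (q : K) (a b : ℤ) :
    symInt q (a - b) = symInt q (a - 1) * symInt q b - symInt q a * symInt q (b - 1) := by
  induction b using Polynomial.Chebyshev.induct with
  | zero => simp [symInt_neg]
  | one => simp
  | add_two n ih₁ ih₀ =>
    have hb := symInt_add_one q (n + 1)
    have hb' := symInt_add_one q n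
    have hab := symInt_add_one q (a - n - 1)
    ring_nf at ih₁ ih₀ hb hb' hab ⊢
    linear_combination (q + q⁻¹) * ih₁ - ih₀ + hab - symInt q (-1 + a) * hb + symInt q a * hb'
  | neg_add_one n ih₁ ih₀ =>
    have hb := symInt_add_one q (-n - 1)
    have hb' := symInt_add_one q (-n)
    have hab := symInt_add_one q (a + n)
    ring_nf at ih₁ ih₀ hb hb' hab ⊢
    linear_combination (q + q⁻¹) * ih₁ - ih₀ + hab + symInt q a * hb - symInt q (-1 + a) * hb'

theorem symInt_inv (q : K) (n : ℤ) : symInt q⁻¹ n = symInt q n := by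
  simp [symInt, add_comm]

theorem symInt_add_one_eq_inv_mul_add_zpow (hq : q ≠ 0) (n : ℤ) :
    symInt q (n + 1) = q⁻¹ * symInt q n + q ^ n := by
  induction n using Int.induction_on with
  | zero => simp
  | succ n ih =>
    have hn := symInt_add_one q (n + 1)
    rw [add_sub_cancel_right] at hn
    rw [hn, zpow_add_one₀ hq]
    linear_combination q * ih + symInt q n * mul_inv_cancel₀ hq
  | pred n ih =>
    have hn := symInt_add_one q (-n)
    rw [sub_add_cancel, zpow_sub_one₀ hq]
    linear_combination q⁻¹ * (ih - hn) - symInt q (-n) * inv_mul_cancel₀ hq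

theorem symInt_add_one_sub_symInt_sub_one (hq : q ≠ 0) (n : ℤ) :
    symInt q (n + 1) - symInt q (n - 1) = q ^ n + q ^ (-n) := by
  have h := symInt_add_one_eq_inv_mul_add_zpow hq n
  have h' := symInt_add_one_eq_inv_mul_add_zpow (inv_ne_zero hq) n
  rw [symInt_inv, symInt_inv, inv_inv, inv_zpow'] at h'
  linear_combination h + h' - symInt_add_one q n

/-- Putting `a = s + 2 * h`, this is the recursion for the generating function of a path. -/
theorem symInt_add_sub_symInt_sub (hq : q ≠ 0) (a s : ℤ) :
    symInt q (a + s) - symInt q (a - s) = (q ^ a + q ^ (-a)) * symInt q s := by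
  have hadd := symInt_sub q a (-s)
  rw [sub_neg_eq_add, ← neg_add', symInt_neg, symInt_neg] at hadd
  linear_combination hadd - symInt_sub q a s + symInt q a * symInt_add_one q s
    - symInt q s * symInt_add_one q a + symInt q s * symInt_add_one_sub_symInt_sub_one hq a

theorem symInt_natCast (hq : q ≠ 0) (n : ℕ) :
    symInt q n = q ^ (1 - n : ℤ) * qInt (q ^ 2) n := by
  induction n with
  | zero => simp [qInt]
  | succ n ih =>
    rw [Nat.cast_succ, symInt_add_one_eq_inv_mul_add_zpow hq, ih, qInt, qInt, sum_range_succ,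
      show (1 : ℤ) - (n + 1) = -n by ring, zpow_sub₀ hq, zpow_neg, zpow_natCast]
    field_simp
    ring

theorem symInt_ne_zero (hq : q ≠ 0) (hqInt : ∀ k : ℕ, 0 < k → qInt (q ^ 2) k ≠ 0)
    {n : ℤ} (hn : 0 < n) : symInt q n ≠ 0 := by
  lift n to ℕ using hn.le
  rw [symInt_natCast hq]
  exact mul_ne_zero (zpow_ne_zero _ hq) (hqInt n (by exact_mod_cast hn))

end SymmetricInteger

section ClosedForm

variable {K : Type*} [Field K] {q : K}

/-- The closed form of the generating function, under the weight `wt1 q`, of the paths with `h`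
lozenges that are not vertical and `s` vertical lozenges. -/
noncomputable def pathProd (q : K) (h : ℤ) (s : ℕ) : K :=
  ∏ t ∈ range s, symInt q (2 * (h + t + 1)) / (2 * symInt q (t + 1))

@[simp] theorem pathProd_zero (q : K) (h : ℤ) : pathProd q h 0 = 1 := by simp [pathProd]

theorem pathProd_succ (q : K) (h : ℤ) (s : ℕ) :
    pathProd q h (s + 1) =
      pathProd q h s * (symInt q (2 * (h + s + 1)) / (2 * symInt q (s + 1))) :=
  prod_range_succ _ _

theorem pathProd_sub_one_succ (q : K) (h : ℤ) (s : ℕ) :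
    pathProd q (h - 1) (s + 1) = pathProd q h s * (symInt q (2 * h) / (2 * symInt q (s + 1))) := by
  simp only [pathProd, prod_div_distrib]
  rw [prod_range_succ', prod_range_succ (fun t : ℕ => 2 * symInt q (t + 1)), mul_div_mul_comm]
  congr! 2
  · refine prod_congr rfl fun t _ => ?_
    rw [Nat.cast_succ, sub_add_add_cancel]
  · simp

theorem pathProd_succ_eq_add (hq : q ≠ 0) {s : ℕ} (hs : symInt q (s + 1) ≠ 0) (h : ℤ) :
    pathProd q h (s + 1) = pathProd q (h - 1) (s + 1) +
      (q ^ (s + 1 + 2 * h) + q ^ (-(s + 1 + 2 * h))) / 2 * pathProd q h s := by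
  have hrec := symInt_add_sub_symInt_sub hq (s + 1 + 2 * h) (s + 1)
  rw [add_sub_cancel_left, show (s : ℤ) + 1 + 2 * h + (s + 1) = 2 * (h + s + 1) by ring,
    sub_eq_iff_eq_add] at hrec
  rw [pathProd_succ, pathProd_sub_one_succ, hrec, add_div, mul_comm 2 (symInt q _), ← div_div,
    mul_div_cancel_right₀ _ hs]
  ring

theorem pathProd_of_neg (q : K) {h : ℤ} {s : ℕ} (hh : h < 0) (hs : 0 ≤ h + s) :
    pathProd q h s = 0 := by
  refine prod_eq_zero (i := (-h - 1).toNat) (mem_range.2 (by omega)) ?_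
  rw [show 2 * (h + ((-h - 1).toNat : ℤ) + 1) = 0 by omega, symInt_zero, zero_div]

theorem pathGF_wt1 (hq : q ≠ 0) (hqInt : ∀ n : ℕ, 0 < n → qInt (q ^ 2) n ≠ 0) (k : ℕ)
    {h : ℤ} {s : ℕ} (hs : 0 ≤ h + s) :
    pathGF (wt1 q) k (s + 2 * h) (2 * k - 2 - s) = pathProd q h s := by
  obtain hi | hi := le_or_gt ((s : ℤ) + 2 * h) 0
  · rw [pathGF_of_nonpos _ hi]
    split_ifs with hj
    · obtain rfl : s = 0 := by omega
      simp
    · exact (pathProd_of_neg q (by omega) hs).symm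
  have hleft := pathGF_wt1 hq hqInt k (h := h - 1) (s := s) (by omega)
  rw [pathGF_of_pos _ hi, wt1, wt1, if_neg (by simp), if_pos rfl, one_mul,
    show (s : ℤ) + 2 * h - 2 = s + 2 * (h - 1) by ring, hleft]
  cases s with
  | zero => simp [pathGF_of_lt]
  | succ s =>
    have habove := pathGF_wt1 hq hqInt k (h := h) (s := s) (by omega)
    rw [pathProd_succ_eq_add hq (symInt_ne_zero hq hqInt (by omega)) h, ← habove]
    push_cast
    ring_nf
termination_by (s + 2 * h).toNat

end ClosedForm

section Determinant

variable {R : Type*} [CommRing R]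

theorem prod_linear_eq_sum {ι : Type*} [DecidableEq ι] (s : Finset ι) (α β : ι → R) (u v : R) :
    ∏ t ∈ s, (α t * u + β t * v) = ∑ k ∈ range (#s + 1),
      (∑ A ∈ powersetCard k s, (∏ t ∈ A, α t) * ∏ t ∈ s \ A, β t) * (u ^ k * v ^ (#s - k)) := by
  rw [prod_add, sum_powerset]
  refine sum_congr rfl fun k _ => ?_
  rw [sum_mul]
  refine sum_congr rfl fun A hA => ?_
  obtain ⟨hAs, rfl⟩ := mem_powersetCard.1 hA
  rw [prod_mul_distrib, prod_mul_distrib, prod_const, prod_const, card_sdiff_of_subset hAs]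
  ring

theorem exists_det_prod_linear_eq {m : ℕ} (α β : Fin m → ℕ → R) :
    ∃ C : R, ∀ u v : Fin m → R,
      (Matrix.of fun r i => ∏ t ∈ range (m - 1), (α r t * u i + β r t * v i)).det =
        C * ∏ i, ∏ j ∈ Ioi i, (u j * v i - u i * v j) := by
  refine ⟨(Matrix.of fun r k : Fin m => ∑ A ∈ powersetCard k (range (m - 1)),
    (∏ t ∈ A, α r t) * ∏ t ∈ range (m - 1) \ A, β r t).det, fun u v => ?_⟩
  rw [← Matrix.det_projVandermonde, ← Matrix.det_transpose (Matrix.projVandermonde u v),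
    ← Matrix.det_mul]
  congr 1
  ext r i
  rw [Matrix.of_apply, prod_linear_eq_sum, Matrix.mul_apply, ← Fin.sum_univ_eq_sum_range (fun k =>
    (∑ A ∈ powersetCard k (range (m - 1)), (∏ t ∈ A, α r t) * ∏ t ∈ range (m - 1) \ A, β r t) *
      (u i ^ k * v i ^ (#(range (m - 1)) - k))), card_range, Nat.sub_add_cancel r.pos]
  refine sum_congr rfl fun k _ => ?_
  rw [Matrix.of_apply, Matrix.transpose_apply, Matrix.projVandermonde_apply, Fin.val_rev,
    Nat.sub_add_eq, Nat.sub_right_comm]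

theorem prod_univ_prod_Ioi {M : Type*} [CommMonoid M] (m : ℕ) (f : ℕ → ℕ → M) :
    ∏ i : Fin m, ∏ j ∈ Ioi i, f i j = ∏ j ∈ range m, ∏ i ∈ range j, f i j := by
  rw [prod_comm' (t' := univ) (s' := fun j => Iio j) (by simp), ← Fin.prod_univ_eq_prod_range
    (fun j => ∏ i ∈ range j, f i j)]
  refine prod_congr rfl fun j _ => ?_
  rw [← Nat.Iio_eq_range, ← Fin.map_valEmbedding_Iio, prod_map]
  rfl

variable {K : Type*} [Field K] {q : K}

/-- Since `[n - a]` is a linear form in `[n - 1]` and `[n]`, this is a determinant of products of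
linear forms. -/
theorem exists_det_symInt_eq (q : K) {m : ℕ} (b : ℕ → ℤ) :
    ∃ C : K, ∀ n : Fin m → ℤ,
      (Matrix.of fun r i : Fin m => (∏ t ∈ range r, symInt q (n i - (t + 1))) *
        ∏ t ∈ Ico (r : ℕ) (m - 1), symInt q (b t - n i)).det =
      C * ∏ i, ∏ j ∈ Ioi i, symInt q (n j - n i) := by
  obtain ⟨C, hC⟩ := exists_det_prod_linear_eq
    (fun (r : Fin m) t => if t < (r : ℕ) then symInt q (t + 1) else -symInt q (b t))
    (fun (r : Fin m) t => if t < (r : ℕ) then -symInt q t else symInt q (b t - 1))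
  refine ⟨C, fun n => ?_⟩
  have hn : ∀ i j, symInt q (n j - n i) =
      symInt q (n j - 1) * symInt q (n i) - symInt q (n i - 1) * symInt q (n j) := fun i j => by
    rw [symInt_sub, mul_comm (symInt q (n j))]
  simp only [hn]
  rw [← hC (fun i => symInt q (n i - 1)) fun i => symInt q (n i)]
  congr 1
  ext r i
  rw [Matrix.of_apply, Matrix.of_apply, ← prod_range_mul_prod_Ico _ (Nat.le_sub_one_of_lt r.2)]
  congr 1
  · refine prod_congr rfl fun t ht => ?_
    rw [if_pos (mem_range.1 ht), if_pos (mem_range.1 ht), symInt_sub, add_sub_cancel_right]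
    ring
  · refine prod_congr rfl fun t ht => ?_
    rw [if_neg (mem_Ico.1 ht).1.not_gt, if_neg (mem_Ico.1 ht).1.not_gt, symInt_sub]
    ring

theorem det_symInt_of_eq_add_one (q : K) {m : ℕ} (b : ℕ → ℤ) :
    (Matrix.of fun r i : Fin m => (∏ t ∈ range r, symInt q ((i + 1 : ℤ) - (t + 1))) *
      ∏ t ∈ Ico (r : ℕ) (m - 1), symInt q (b t - (i + 1))).det =
    (∏ r ∈ range m, ∏ t ∈ Ico r (m - 1), symInt q (b t - (r + 1))) *
      ∏ i : Fin m, ∏ j ∈ Ioi i, symInt q ((j + 1 : ℤ) - (i + 1)) := by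
  rw [Matrix.det_of_isUpperTriangular,
    prod_univ_prod_Ioi m fun i j => symInt q ((j + 1 : ℤ) - (i + 1)), ← prod_mul_distrib,
    ← Fin.prod_univ_eq_prod_range fun r => (∏ t ∈ Ico r (m - 1), symInt q (b t - (r + 1))) *
      ∏ t ∈ range r, symInt q ((r + 1 : ℤ) - (t + 1))]
  · exact prod_congr rfl fun r _ => mul_comm _ _
  · intro r i hir
    refine mul_eq_zero_of_left (prod_eq_zero (i := (i : ℕ)) (mem_range.2 hir) ?_) _
    rw [sub_self, symInt_zero]

/-- A `q`-analogue of Krattenthaler's determinant; the constant in front of the Vandermonde product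
is found from the case `n i = i + 1`, where the matrix is triangular. -/
theorem det_symInt (hq : q ≠ 0) (hqInt : ∀ k : ℕ, 0 < k → qInt (q ^ 2) k ≠ 0) {m : ℕ}
    (b : ℕ → ℤ) (n : Fin m → ℤ) :
    (Matrix.of fun r i : Fin m => (∏ t ∈ range r, symInt q (n i - (t + 1))) *
      ∏ t ∈ Ico (r : ℕ) (m - 1), symInt q (b t - n i)).det =
    (∏ r ∈ range m, ∏ t ∈ Ico r (m - 1), symInt q (b t - (r + 1))) *
      ∏ i, ∏ j ∈ Ioi i, symInt q (n j - n i) := by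
  obtain ⟨C, hC⟩ := exists_det_symInt_eq q b
  have hne : ∏ i : Fin m, ∏ j ∈ Ioi i, symInt q ((j + 1 : ℤ) - (i + 1)) ≠ 0 :=
    prod_ne_zero_iff.2 fun i _ => prod_ne_zero_iff.2 fun j hj =>
      symInt_ne_zero hq hqInt (by have : i < j := mem_Ioi.1 hj; omega)
  rw [hC n, mul_right_cancel₀ hne ((hC fun i => i + 1).symm.trans (det_symInt_of_eq_add_one q b))]

end Determinant

section Evaluation

variable {K : Type*} [Field K] {q : K}

/-- The symmetric `q`-factorial `[1] [2] ⋯ [n]`. -/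
noncomputable def symFact (q : K) (n : ℕ) : K := ∏ t ∈ range n, symInt q (t + 1)

/-- The symmetric double `q`-factorial `[2] [4] ⋯ [2 n]`. -/
noncomputable def symDoubleFact (q : K) (n : ℕ) : K := ∏ t ∈ range n, symInt q (2 * (t + 1))

theorem symFact_ne_zero (hq : q ≠ 0) (hqInt : ∀ k : ℕ, 0 < k → qInt (q ^ 2) k ≠ 0) (n : ℕ) :
    symFact q n ≠ 0 :=
  prod_ne_zero_iff.2 fun _ _ => symInt_ne_zero hq hqInt (by omega)

theorem symDoubleFact_ne_zero (hq : q ≠ 0) (hqInt : ∀ k : ℕ, 0 < k → qInt (q ^ 2) k ≠ 0) (n : ℕ) :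
    symDoubleFact q n ≠ 0 :=
  prod_ne_zero_iff.2 fun _ _ => symInt_ne_zero hq hqInt (by omega)

theorem symFact_add (q : K) (n k : ℕ) :
    symFact q (n + k) = symFact q n * ∏ t ∈ range k, symInt q (n + k - t) := by
  rw [symFact, prod_range_add, symFact, ← prod_range_reflect _ k]
  refine congrArg _ (prod_congr rfl fun t ht => congrArg _ ?_)
  have := mem_range.1 ht
  omega

theorem symDoubleFact_add (q : K) (n k : ℕ) :
    symDoubleFact q (n + k) = symDoubleFact q n * ∏ t ∈ range k, symInt q (2 * (n + t + 1)) := by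
  rw [symDoubleFact, prod_range_add, symDoubleFact]
  push_cast
  rfl

/-- The quotient only depends on `h + s` and `s + r`, which makes it a factor of a column of the
path matrix; the two products are an entry of the matrix evaluated in `det_symInt`. -/
theorem pathProd_natCast (hq : q ≠ 0) (h2 : (2 : K) ≠ 0)
    (hqInt : ∀ k : ℕ, 0 < k → qInt (q ^ 2) k ≠ 0) (h s r u : ℕ) :
    pathProd q h s = 2 ^ (r + 1) *
      (symDoubleFact q (h + s) /
          (symDoubleFact q (h + u) * (2 ^ (s + r + 1) * symFact q (s + r))) *
        ((∏ t ∈ range r, symInt q (s + r - t)) *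
          ∏ t ∈ range u, symInt q (2 * (h + t + 1)))) := by
  have hfact := symFact_ne_zero hq hqInt (s + r)
  have hdouble := symDoubleFact_ne_zero hq hqInt (h + u)
  rw [symFact_add, mul_ne_zero_iff] at hfact
  rw [symDoubleFact_add, mul_ne_zero_iff] at hdouble
  obtain ⟨hs, hsr⟩ := hfact
  obtain ⟨hh, hhu⟩ := hdouble
  rw [pathProd, prod_div_distrib, prod_mul_distrib, prod_const, card_range, ← symFact, symFact_add,
    symDoubleFact_add, symDoubleFact_add, add_assoc s, pow_add 2 s]
  field_simp

theorem pathGF_wt1_start (hq : q ≠ 0) (h2 : (2 : K) ≠ 0)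
    (hqInt : ∀ k : ℕ, 0 < k → qInt (q ^ 2) k ≠ 0) {c m r k : ℕ} (hr : r < m) (hk : 1 ≤ k)
    (hkm : k ≤ c + m) :
    pathGF (wt1 q) k (2 * (c + 1) + (r - 1)) (r - 1) = 2 ^ (r + 1) *
      (symDoubleFact q (c + k) /
          (symDoubleFact q (c + m - k) * (2 ^ (2 * k) * symFact q (2 * k - 1))) *
        ((∏ t ∈ range r, symInt q (2 * k - (t + 1))) *
          ∏ t ∈ Ico r (m - 1), symInt q (2 * (c + t + 2) - 2 * k))) := by
  obtain hrk | hrk := le_or_gt (2 * k) r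
  · have hzero : ∏ t ∈ range r, symInt q (2 * k - (t + 1)) = 0 :=
      prod_eq_zero (i := 2 * k - 1) (mem_range.2 (by omega)) (by
        rw [show 2 * (k : ℤ) - ((2 * k - 1 : ℕ) + 1) = 0 by omega, symInt_zero])
    rw [pathGF_of_lt _ (by omega), hzero]
    ring
  obtain ⟨s, hs⟩ : ∃ s : ℕ, 2 * k = s + r + 1 := ⟨2 * k - 1 - r, by omega⟩
  have hpath := pathGF_wt1 hq hqInt k (h := c + 1 + r - k) (s := s) (by omega)
  rw [show (s : ℤ) + 2 * (c + 1 + r - k) = 2 * (c + 1) + (r - 1) by omega,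
    show 2 * (k : ℤ) - 2 - s = r - 1 by omega] at hpath
  rw [hpath]
  obtain hh | hh := lt_or_ge (c + 1 + r) k
  · have hzero : ∏ t ∈ Ico r (m - 1), symInt q (2 * (c + t + 2) - 2 * k) = 0 :=
      prod_eq_zero (i := k - c - 2) (mem_Ico.2 (by omega)) (by
        rw [show 2 * ((c : ℤ) + (k - c - 2 : ℕ) + 2) - 2 * k = 0 by omega, symInt_zero])
    rw [pathProd_of_neg q (by omega) (by omega), hzero]
    ring
  obtain ⟨h, hh⟩ := Nat.exists_eq_add_of_le hh
  rw [show (c : ℤ) + 1 + r - k = h by omega, pathProd_natCast hq h2 hqInt h s r (m - 1 - r),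
    show c + k = h + s by omega, show c + m - k = h + (m - 1 - r) by omega,
    show 2 * k - 1 = s + r by omega, hs, prod_Ico_eq_prod_range]
  congr 3
  · exact prod_congr rfl fun t _ => congrArg _ (by omega)
  · exact prod_congr rfl fun t _ => congrArg _ (by omega)

/-- The product `P` of type A in terms of symmetric `q`-integers, which absorb the power of `q`;
here `c` is `x̄` and `k i` is `l_{i+1}`. The factors are those of the determinant: the powers of `2`
come from the rows, the second product from the columns. -/
noncomputable def symProduct (q : K) (c m : ℕ) (k : ℕ → ℕ) : K :=
  (∏ r ∈ range m, 2 ^ (r + 1)) *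
    ((∏ i ∈ range m, symDoubleFact q (c + k i) /
        (symDoubleFact q (c + m - k i) * (2 ^ (2 * k i) * symFact q (2 * k i - 1)))) *
      ((∏ r ∈ range m, ∏ t ∈ Ico r (m - 1), symInt q (2 * (c + t + 2) - (r + 1))) *
        ∏ j ∈ range m, ∏ i ∈ range j, symInt q (2 * k j - 2 * k i)))

theorem det_pathGF_wt1 (hq : q ≠ 0) (h2 : (2 : K) ≠ 0)
    (hqInt : ∀ k : ℕ, 0 < k → qInt (q ^ 2) k ≠ 0) {c m : ℕ} {k : ℕ → ℕ}
    (hk : ∀ i < m, k i ∈ Set.Icc 1 (c + m)) :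
    (Matrix.of fun r i : Fin m => pathGF (wt1 q) (k i) (2 * (c + 1) + (r - 1)) (r - 1)).det =
      symProduct q c m k := by
  let column (i : ℕ) : K := symDoubleFact q (c + k i) /
    (symDoubleFact q (c + m - k i) * (2 ^ (2 * k i) * symFact q (2 * k i - 1)))
  let A : Matrix (Fin m) (Fin m) K := .of fun r i => (∏ t ∈ range r, symInt q (2 * k i - (t + 1))) *
    ∏ t ∈ Ico (r : ℕ) (m - 1), symInt q (2 * (c + t + 2) - 2 * k i)
  have hentry : (Matrix.of fun r i : Fin m =>
      pathGF (wt1 q) (k i) (2 * (c + 1) + (r - 1)) (r - 1)) = Matrix.of fun r i : Fin m =>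
        2 ^ ((r : ℕ) + 1) * (Matrix.of fun r i : Fin m => column i * A r i) r i := by
    ext r i
    exact pathGF_wt1_start hq h2 hqInt r.2 (hk i i.2).1 (hk i i.2).2
  rw [hentry, Matrix.det_mul_column, Matrix.det_mul_row,
    det_symInt hq hqInt (fun t => 2 * (c + t + 2)) fun i : Fin m => 2 * (k i : ℤ),
    prod_univ_prod_Ioi m fun i j => symInt q (2 * k j - 2 * k i),
    Fin.prod_univ_eq_prod_range fun r => (2 : K) ^ (r + 1), Fin.prod_univ_eq_prod_range column,
    symProduct]

theorem tgf_regionA_wt1 (hq : q ≠ 0) (h2 : (2 : K) ≠ 0)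
    (hqInt : ∀ k : ℕ, 0 < k → qInt (q ^ 2) k ≠ 0) {x d m : ℕ} (hmd : m ≤ d) {l : ℕ → ℕ}
    (hl : StrictMonoOn l (Set.Icc 1 m)) (hlb : ∀ i ∈ Set.Icc 1 m, l i ∈ Set.Icc 1 d) :
    tgf (wt1 q) (regionA x d m l) = symProduct q (x + (d - m)) m fun i => l (i + 1) := by
  rw [tgf_regionA_eq_det (wt1 q) (fun i _ => if_neg (sub_one_lt i).ne') hmd hl hlb,
    ← det_pathGF_wt1 hq h2 hqInt]
  · push_cast [hmd]
    rw [add_sub_assoc]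
  · intro i hi
    obtain ⟨h1, hd⟩ := hlb (i + 1) ⟨by omega, hi⟩
    exact ⟨h1, by omega⟩

end Evaluation

section Exponents

theorem two_mul_sum_range_natCast (n : ℕ) : 2 * ∑ i ∈ range n, (i : ℤ) = n * (n - 1) := by
  induction n with
  | zero => simp
  | succ n ih =>
    rw [sum_range_succ, mul_add, ih]
    push_cast
    ring

theorem two_mul_angle {a b : ℤ} (hab : a ≤ b + 1) : 2 * angle b a = (b + 1 - a) * (a + b) := by
  obtain ⟨n, hn⟩ := Int.le.dest hab
  obtain rfl : b = a + n - 1 := by omega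
  clear hn hab
  induction n with
  | zero => simp [angle]
  | succ n ih =>
    rw [angle, Nat.cast_succ, ← add_assoc, add_sub_right_comm,
      ← insert_Icc_right_eq_Icc_add_one (by omega), sum_insert (by simp), mul_add, ← angle, ih]
    ring

theorem sum_range_sum_range_sub (m : ℕ) (L : ℕ → ℤ) :
    ∑ j ∈ range m, ∑ i ∈ range j, (L j - L i) = ∑ j ∈ range m, (2 * j + 1 - m) * L j := by
  induction m with
  | zero => simp
  | succ m ih =>
    rw [sum_range_succ, ih, sum_range_succ]
    simp only [sub_mul, add_mul, one_mul, sum_sub_distrib, sum_add_distrib, ← mul_sum, sum_const,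
      card_range, nsmul_eq_mul]
    push_cast
    ring

theorem sum_range_arith (n : ℕ) (a : ℤ) : ∑ s ∈ range n, (a + 2 * s + 1) = n * (a + n) := by
  induction n with
  | zero => simp
  | succ n ih =>
    rw [sum_range_succ, ih]
    push_cast
    ring

theorem sum_range_sum_range_arith (m : ℕ) (a : ℤ) :
    ∑ r ∈ range m, ∑ s ∈ range (m - r), (a + r + 2 * s + 1) =
      ∑ i ∈ range m, ((i : ℤ) + 1) * (a + m) := by
  rw [← sum_range_reflect]
  refine sum_congr rfl fun i hi => ?_
  have hi := mem_range.1 hi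
  rw [sum_range_arith, show m - (m - 1 - i) = i + 1 by omega, show m - 1 - i = m - (i + 1) by omega]
  push_cast [Nat.cast_sub hi]
  ring

theorem sum_succ_mul_eq_zero (m : ℕ) :
    ∑ i ∈ range m, ((i : ℤ) + 1) * (2 * m - 2 - 3 * i) = 0 := by
  have htelescope (i : ℕ) : ((i : ℤ) + 1) * (2 * m - 2 - 3 * i) =
      (i + 1 : ℕ) * ((i + 1 : ℕ) + 1) * (m - (i + 1 : ℕ)) - i * (i + 1) * (m - i) := by
    push_cast
    ring
  simp only [htelescope]
  rw [sum_range_sub fun i : ℕ => (i : ℤ) * (i + 1) * (m - i)]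
  simp

/-- The powers of `q` in the theorem cancel: the left-hand side is `2 * E`; the sums on the right
come from the Vandermonde product, the factorials, and the last two products of `P`. -/
theorem two_mul_expE_identity (c : ℤ) (m : ℕ) (L : ℕ → ℤ) :
    ∑ i ∈ range m, (2 * L i - (i + 1)) * (4 * c + 1 + 3 * (i + 1) - 2 * L i) =
      2 * (∑ j ∈ range m, ∑ i ∈ range j, (2 * (L j - L i) - 1))
      - ∑ i ∈ range m, (2 * L i - 1) * (2 * L i - 2)
      + 2 * (∑ r ∈ range m, ∑ s ∈ range (m - r), (2 * c + r + 2 * s + 1))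
      + 2 * ∑ i ∈ range m, (L i - (i + 1)) * (4 * c + 2 * m) := by
  have hvandermonde : ∑ j ∈ range m, ∑ i ∈ range j, (2 * (L j - L i) - 1) =
      ∑ j ∈ range m, (2 * ((2 * j + 1 - m) * L j) - j) := by
    simp only [sum_sub_distrib, ← mul_sum, ← sum_range_sum_range_sub]
    simp
  rw [hvandermonde, sum_range_sum_range_arith, ← sub_eq_zero, ← sum_succ_mul_eq_zero m]
  simp only [mul_sum, ← sum_sub_distrib, ← sum_add_distrib]
  refine sum_congr rfl fun i _ => ?_
  ring

end Exponents

section Reindexing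

variable {M : Type*} [CommMonoid M]

@[to_additive]
theorem prod_Icc_eq_prod_range_succ (m : ℕ) (f : ℕ → M) :
    ∏ i ∈ Icc 1 m, f i = ∏ i ∈ range m, f (i + 1) := by
  rw [range_eq_Ico, prod_Ico_add' f 0 m 1]
  rfl

theorem prod_Icc_prod_Icc (m : ℕ) (f : ℕ → ℕ → M) :
    ∏ i ∈ Icc 1 m, ∏ j ∈ Icc (i + 1) m, f i j =
      ∏ j ∈ range m, ∏ i ∈ range j, f (i + 1) (j + 1) := by
  rw [prod_comm' (t' := Icc 1 m) (s' := fun j => Icc 1 (j - 1))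
    (by intro i j; simp only [mem_Icc]; omega), prod_Icc_eq_prod_range_succ]
  refine prod_congr rfl fun j _ => ?_
  rw [prod_Icc_eq_prod_range_succ, Nat.add_sub_cancel]

/-- Removing from the triangle `r + s < m + 2` its first row and its last diagonal, whose values
`r + 2 * s + 2` are `2, …, 2 * m + 4`, leaves a translate of the triangle `r + s < m`. -/
theorem prod_triangle_add_two (m : ℕ) (f : ℕ → M) :
    ∏ s ∈ range (m + 2), ∏ r ∈ range (m + 2 - s), f (r + 2 * s + 2) =
      (∏ s ∈ range m, ∏ r ∈ range (m - s), f (r + 2 * s + 2 + 2)) *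
        ∏ j ∈ range (2 * m + 3), f (j + 2) := by
  have hdiagonal : ∏ s ∈ range (m + 1), ∏ r ∈ range (m + 2 - (s + 1)), f (r + 2 * (s + 1) + 2) =
      (∏ s ∈ range m, ∏ r ∈ range (m - s), f (r + 2 * s + 2 + 2)) *
        ∏ s ∈ range (m + 1), f (m + 2 + s + 2) := by
    rw [← mul_one (∏ s ∈ range m, _), ← prod_range_zero fun r => f (r + 2 * m + 2 + 2),
      ← Nat.sub_self m, ← prod_range_succ fun s => ∏ r ∈ range (m - s), f (r + 2 * s + 2 + 2),
      ← prod_mul_distrib]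
    refine prod_congr rfl fun s hs => ?_
    have hs := mem_range.1 hs
    rw [show m + 2 - (s + 1) = m - s + 1 by omega, prod_range_succ,
      show m - s + 2 * (s + 1) + 2 = m + 2 + s + 2 by omega]
    rfl
  rw [prod_range_succ', hdiagonal, show 2 * m + 3 = m + 2 + (m + 1) by ring,
    prod_range_add (fun j => f (j + 2)), mul_right_comm, mul_assoc]
  rfl

theorem prod_staircase (m : ℕ) (f : ℕ → M) :
    ∏ i ∈ Icc 1 ((m + 1) / 2), ∏ j ∈ Icc 1 (2 * m + 3 - 4 * i), f (2 * i + j - 1) =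
      ∏ r ∈ range m, ∏ s ∈ range (m - r), f (r + 2 * s + 2) := by
  suffices h : _ = ∏ s ∈ range m, ∏ r ∈ range (m - s), f (r + 2 * s + 2) from
    h.trans (prod_comm' (by intro s r; simp only [mem_range]; omega))
  simp only [prod_Icc_eq_prod_range_succ]
  induction m using Nat.twoStepInduction generalizing f with
  | zero => simp
  | one => simp
  | more m ih _ =>
    rw [prod_triangle_add_two, ← ih fun w => f (w + 2),
      show (m + 2 + 1) / 2 = (m + 1) / 2 + 1 by omega, prod_range_succ']
    congr 1
    · refine prod_congr rfl fun i _ => prod_congr (by congr 1; omega) fun j _ => ?_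
      congr 1
      omega
    · exact prod_congr rfl fun j _ => by congr 1; omega

end Reindexing

section Product

theorem xBar_zero (x d m : ℕ) : xBar x 0 d m 0 = x + (d - m) := by
  simp [xBar]

theorem expF_zero (m : ℕ) (l h : ℕ → ℕ) :
    expF m 0 l h = ∑ i ∈ range m, (2 * (l (i + 1) : ℤ) - (i + 1)) := by
  simp [expF, sum_Icc_eq_sum_range_succ]

theorem two_mul_expE_zero {d m : ℕ} (hmd : m ≤ d) (x : ℕ) {l : ℕ → ℕ} (h : ℕ → ℕ)
    (hl : ∀ i < m, i + 1 ≤ l (i + 1)) :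
    2 * expE x 0 d m 0 l h = ∑ i ∈ range m, (2 * (l (i + 1) : ℤ) - (i + 1)) *
      (4 * (x + (d - m) : ℕ) + 1 + 3 * (i + 1) - 2 * l (i + 1)) := by
  have ht : t1Param x 0 d m 0 = 2 * x + 1 := by
    rw [t1Param, eParam, min_eq_left (by omega)]
    ring
  simp only [expE, auxf, ht, sum_Icc_eq_sum_range_succ, range_zero, sum_empty, add_zero, mul_sum,
    Nat.cast_zero, zero_mul, Int.zero_ediv, zero_add]
  refine sum_congr rfl fun i hi => ?_
  have hli := hl i (mem_range.1 hi)
  rw [two_mul_angle (by omega)]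
  push_cast [hmd]
  ring

theorem le_of_strictMonoOn {m : ℕ} {l : ℕ → ℕ} (hl : StrictMonoOn l (Set.Icc 1 m))
    (hl_pos : ∀ i ∈ Set.Icc 1 m, 1 ≤ l i) {i : ℕ} (hi : i < m) : i + 1 ≤ l (i + 1) := by
  induction i with
  | zero => exact hl_pos 1 ⟨le_rfl, hi⟩
  | succ i ih =>
    exact (ih (by omega)).trans_lt (hl ⟨by omega, by omega⟩ ⟨by omega, hi⟩ (lt_add_one (i + 1)))

variable {K : Type*} [Field K] {q : K}

theorem prod_zpow_eq_zpow_sum (hq : q ≠ 0) {ι : Type*} (s : Finset ι) (f : ι → ℤ) :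
    ∏ i ∈ s, q ^ f i = q ^ ∑ i ∈ s, f i := by
  induction s using Finset.cons_induction with
  | empty => simp
  | cons a s ha ih => rw [prod_cons, sum_cons, zpow_add₀ hq, ih]

theorem prod_two_pow_div (h2 : (2 : K) ≠ 0) (m : ℕ) (k : ℕ → ℕ) :
    (∏ r ∈ range m, (2 : K) ^ (r + 1)) / ∏ i ∈ range m, (2 : K) ^ (2 * k i) =
      2 ^ (-∑ i ∈ range m, (2 * (k i : ℤ) - (i + 1))) := by
  rw [← prod_div_distrib, ← sum_neg_distrib, ← prod_zpow_eq_zpow_sum h2]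
  refine prod_congr rfl fun i _ => ?_
  rw [neg_sub, zpow_sub₀ h2]
  norm_cast

theorem qInt_sq_eq (hq : q ≠ 0) (n : ℕ) : qInt (q ^ 2) n = q ^ (n - 1 : ℤ) * symInt q n := by
  rw [symInt_natCast hq, ← mul_assoc, ← zpow_add₀ hq]
  simp

theorem prod_qInt_sq_eq (hq : q ≠ 0) {ι : Type*} (s : Finset ι) (f : ι → ℕ) :
    ∏ i ∈ s, qInt (q ^ 2) (f i) = q ^ (∑ i ∈ s, (f i - 1 : ℤ)) * ∏ i ∈ s, symInt q (f i) := by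
  simp only [qInt_sq_eq hq, prod_mul_distrib, prod_zpow_eq_zpow_sum hq]

theorem prod_prod_qInt_sq_eq (hq : q ≠ 0) {ι κ : Type*} (s : Finset ι) (t : ι → Finset κ)
    (f : ι → κ → ℕ) :
    ∏ i ∈ s, ∏ j ∈ t i, qInt (q ^ 2) (f i j) =
      q ^ (∑ i ∈ s, ∑ j ∈ t i, (f i j - 1 : ℤ)) * ∏ i ∈ s, ∏ j ∈ t i, symInt q (f i j) := by
  simp only [prod_qInt_sq_eq hq, prod_mul_distrib, prod_zpow_eq_zpow_sum hq]

theorem qFact_sq_eq (hq : q ≠ 0) (n : ℕ) :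
    qFact (q ^ 2) n = q ^ (∑ k ∈ range n, (k : ℤ)) * symFact q n := by
  rw [qFact, prod_Icc_eq_prod_range_succ, prod_qInt_sq_eq hq, symFact]
  simp

theorem prod_qFact_sq_eq (hq : q ≠ 0) (m : ℕ) (l : ℕ → ℕ) :
    ∏ i ∈ Icc 1 m, qFact (q ^ 2) (2 * l i - 1) =
      q ^ (∑ i ∈ range m, ∑ k ∈ range (2 * l (i + 1) - 1), (k : ℤ)) *
        ∏ i ∈ range m, symFact q (2 * l (i + 1) - 1) := by
  rw [prod_Icc_eq_prod_range_succ]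
  simp only [qFact_sq_eq hq, prod_mul_distrib, prod_zpow_eq_zpow_sum hq]

theorem prod_qInt_sq_sub_eq (hq : q ≠ 0) {m : ℕ} {l : ℕ → ℕ} (hl : MonotoneOn l (Set.Icc 1 m)) :
    ∏ i ∈ Icc 1 m, ∏ j ∈ Icc (i + 1) m, qInt (q ^ 2) (2 * (l j - l i)) =
      q ^ (∑ j ∈ range m, ∑ i ∈ range j, (2 * (l (j + 1) - l (i + 1)) - 1 : ℤ)) *
        ∏ j ∈ range m, ∏ i ∈ range j, symInt q (2 * l (j + 1) - 2 * l (i + 1)) := by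
  have hcast {i j : ℕ} (hj : j ∈ range m) (hi : i ∈ range j) :
      ((2 * (l (j + 1) - l (i + 1)) : ℕ) : ℤ) = 2 * (l (j + 1) - l (i + 1)) := by
    rw [mem_range] at hi hj
    push_cast [hl ⟨by omega, by omega⟩ ⟨by omega, hj⟩ (Nat.succ_le_succ hi.le)]
    rfl
  rw [prod_Icc_prod_Icc, prod_prod_qInt_sq_eq hq,
    sum_congr rfl fun j hj => sum_congr rfl fun i hi => by rw [hcast hj hi],
    prod_congr rfl fun j hj => prod_congr rfl fun i hi => by rw [hcast hj hi, mul_sub]]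

theorem prod_qInt_sq_staircase_eq (hq : q ≠ 0) (c m : ℕ) :
    ∏ i ∈ Icc 1 ((m + 1) / 2), ∏ j ∈ Icc 1 (2 * m + 3 - 4 * i),
        qInt (q ^ 2) (2 * c + 2 * i + j - 1) =
      q ^ (∑ r ∈ range m, ∑ s ∈ range (m - r), (2 * c + r + 2 * s + 1 : ℤ)) *
        ((∏ t ∈ range m, symInt q (2 * (c + t + 1))) *
          ∏ r ∈ range m, ∏ t ∈ Ico r (m - 1), symInt q (2 * (c + t + 2) - (r + 1))) := by
  have hassoc {i : ℕ} (hi : i ∈ Icc 1 ((m + 1) / 2)) (j : ℕ) :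
      2 * c + 2 * i + j - 1 = 2 * c + (2 * i + j - 1) := by
    have := (mem_Icc.1 hi).1
    omega
  rw [prod_congr rfl fun i hi => prod_congr rfl fun j _ => by rw [hassoc hi j],
    prod_staircase m fun w => qInt (q ^ 2) (2 * c + w), prod_prod_qInt_sq_eq hq]
  push_cast
  congr 1
  · exact congrArg _ (sum_congr rfl fun r _ => sum_congr rfl fun s _ => by ring)
  obtain _ | m := m
  · simp
  rw [prod_range_succ', prod_range_succ (fun r => ∏ t ∈ Ico r (m + 1 - 1), _), mul_comm]
  simp only [prod_Ico_eq_prod_range, Nat.add_sub_add_right, Nat.sub_self, Nat.sub_zero,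
    Nat.add_sub_cancel, prod_range_zero, mul_one]
  push_cast
  congr 1
  · exact prod_congr rfl fun t _ => congrArg _ (by ring)
  · exact prod_congr rfl fun r _ => prod_congr rfl fun t _ => congrArg _ (by ring)

theorem prod_qInt_sq_pair_eq (hq : q ≠ 0) (hqInt : ∀ k : ℕ, 0 < k → qInt (q ^ 2) k ≠ 0)
    {c m i k : ℕ} (hik : i ≤ k) (hk : k ≤ c + m) :
    ∏ j ∈ Icc 1 (k - i), (qInt (q ^ 2) (2 * (c + i + j)) *
        qInt (q ^ 2) (2 * (c + m + 1 - i - j))) =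
      q ^ ((k - i) * (4 * c + 2 * m) : ℤ) *
        (symDoubleFact q (c + k) / symDoubleFact q (c + m - k) *
          (symDoubleFact q (c + m - i) / symDoubleFact q (c + i))) := by
  obtain ⟨n, rfl⟩ := Nat.exists_eq_add_of_le hik
  have hlower : symDoubleFact q (c + (i + n)) / symDoubleFact q (c + i) =
      ∏ j ∈ range n, symInt q (2 * (c + i + (j + 1)) : ℕ) := by
    rw [← add_assoc, symDoubleFact_add, mul_div_cancel_left₀ _ (symDoubleFact_ne_zero hq hqInt _)]
    push_cast
    simp only [add_assoc]
  have hupper : symDoubleFact q (c + m - i) / symDoubleFact q (c + m - (i + n)) =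
      ∏ j ∈ range n, symInt q (2 * (c + m + 1 - i - (j + 1)) : ℕ) := by
    rw [show c + m - i = c + m - (i + n) + n by omega, symDoubleFact_add,
      mul_div_cancel_left₀ _ (symDoubleFact_ne_zero hq hqInt _), ← prod_range_reflect]
    refine prod_congr rfl fun j hj => congrArg _ ?_
    have := mem_range.1 hj
    omega
  have hexp : ∑ j ∈ range n, ((2 * (c + i + (j + 1)) : ℕ) - 1 : ℤ) +
      ∑ j ∈ range n, ((2 * (c + m + 1 - i - (j + 1)) : ℕ) - 1 : ℤ) = n * (4 * c + 2 * m) := by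
    rw [← sum_add_distrib, ← nsmul_eq_mul, ← card_range n, ← sum_const]
    refine sum_congr (by simp) fun j hj => ?_
    have := mem_range.1 hj
    omega
  rw [Nat.add_sub_cancel_left, prod_mul_distrib, prod_Icc_eq_prod_range_succ,
    prod_Icc_eq_prod_range_succ, prod_qInt_sq_eq hq, prod_qInt_sq_eq hq, ← hlower, ← hupper,
    mul_mul_mul_comm, ← zpow_add₀ hq, hexp, div_mul_div_comm, div_mul_div_comm,
    mul_comm (symDoubleFact q (c + i)), Nat.cast_add, add_sub_cancel_left]

theorem prod_symDoubleFact_div (hq : q ≠ 0) (hqInt : ∀ k : ℕ, 0 < k → qInt (q ^ 2) k ≠ 0)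
    (c m : ℕ) :
    (∏ i ∈ range m, symDoubleFact q (c + m - (i + 1)) / symDoubleFact q (c + (i + 1))) *
      ∏ t ∈ range m, symInt q (2 * (c + t + 1)) = 1 := by
  have hreflect : ∏ i ∈ range m, symDoubleFact q (c + m - (i + 1)) =
      ∏ i ∈ range m, symDoubleFact q (c + i) := by
    rw [← prod_range_reflect]
    refine prod_congr rfl fun i hi => congrArg _ ?_
    have := mem_range.1 hi
    omega
  rw [prod_div_distrib, hreflect, ← prod_div_distrib, ← prod_mul_distrib]
  refine prod_eq_one fun i _ => ?_
  rw [← add_assoc, symDoubleFact_add q (c + i) 1, prod_range_one]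
  push_cast
  rw [add_zero, ← div_div, div_self (symDoubleFact_ne_zero hq hqInt _), one_div,
    inv_mul_cancel₀ (symInt_ne_zero hq hqInt (by omega))]

theorem prod_prod_qInt_sq_pair_eq (hq : q ≠ 0) (hqInt : ∀ k : ℕ, 0 < k → qInt (q ^ 2) k ≠ 0)
    {c m : ℕ} {l : ℕ → ℕ} (hl : ∀ i < m, i + 1 ≤ l (i + 1)) (hlc : ∀ i < m, l (i + 1) ≤ c + m) :
    ∏ i ∈ Icc 1 m, ∏ j ∈ Icc 1 (l i - i), (qInt (q ^ 2) (2 * (c + i + j)) *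
        qInt (q ^ 2) (2 * (c + m + 1 - i - j))) =
      q ^ (∑ i ∈ range m, (l (i + 1) - (i + 1)) * (4 * c + 2 * m) : ℤ) *
        ((∏ i ∈ range m, symDoubleFact q (c + l (i + 1)) / symDoubleFact q (c + m - l (i + 1))) *
          ∏ i ∈ range m, symDoubleFact q (c + m - (i + 1)) / symDoubleFact q (c + (i + 1))) := by
  rw [prod_Icc_eq_prod_range_succ, ← prod_zpow_eq_zpow_sum hq, ← prod_mul_distrib,
    ← prod_mul_distrib]
  refine prod_congr rfl fun i hi => ?_
  have hi := mem_range.1 hi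
  rw [prod_qInt_sq_pair_eq hq hqInt (hl i hi) (hlc i hi), Nat.cast_succ]

theorem neg_expE_zero_add_eq_zero {d m : ℕ} (hmd : m ≤ d) (x : ℕ) {l : ℕ → ℕ} (h : ℕ → ℕ)
    (hl : ∀ i < m, i + 1 ≤ l (i + 1)) :
    -expE x 0 d m 0 l h
      + (∑ j ∈ range m, ∑ i ∈ range j, (2 * (l (j + 1) - l (i + 1)) - 1 : ℤ)
        - ∑ i ∈ range m, ∑ k ∈ range (2 * l (i + 1) - 1), (k : ℤ))
      + ∑ r ∈ range m, ∑ s ∈ range (m - r), (2 * (x + (d - m) : ℕ) + r + 2 * s + 1 : ℤ)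
      + ∑ i ∈ range m, (l (i + 1) - (i + 1)) * (4 * (x + (d - m) : ℕ) + 2 * m : ℤ) = 0 := by
  have hfact : 2 * ∑ i ∈ range m, ∑ k ∈ range (2 * l (i + 1) - 1), (k : ℤ) =
      ∑ i ∈ range m, (2 * l (i + 1) - 1 : ℤ) * (2 * l (i + 1) - 2) := by
    rw [mul_sum]
    refine sum_congr rfl fun i hi => ?_
    have := hl i (mem_range.1 hi)
    rw [two_mul_sum_range_natCast, show ((2 * l (i + 1) - 1 : ℕ) : ℤ) = 2 * l (i + 1) - 1 by omega]
    ring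
  linarith [two_mul_expE_zero hmd x h hl,
    two_mul_expE_identity (x + (d - m) : ℕ) m fun i => l (i + 1)]

theorem P_zero_eq_symProduct (hq : q ≠ 0) (h2 : (2 : K) ≠ 0)
    (hqInt : ∀ k : ℕ, 0 < k → qInt (q ^ 2) k ≠ 0) {x d m : ℕ} (hmd : m ≤ d) {l : ℕ → ℕ}
    (hl : StrictMonoOn l (Set.Icc 1 m)) (hlb : ∀ i ∈ Set.Icc 1 m, l i ∈ Set.Icc 1 d)
    (h : ℕ → ℕ) :
    P q x 0 d m 0 l h = symProduct q (x + (d - m)) m fun i => l (i + 1) := by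
  have hle : ∀ i < m, i + 1 ≤ l (i + 1) := fun i hi =>
    le_of_strictMonoOn hl (fun i hi => (hlb i hi).1) hi
  have hlc : ∀ i < m, l (i + 1) ≤ x + (d - m) + m := fun i hi =>
    (hlb (i + 1) ⟨by omega, hi⟩).2.trans (by omega)
  have hcollect (a b : K) (e f : ℤ) : a * q ^ e * (q ^ f * b) = a * b * q ^ (e + f) := by
    rw [zpow_add₀ hq]
    ring
  have hcancel {t u : K} (htu : u * t = 1) (a b c : K) : a * (t * b) * (c * u) = a * b * c := by
    linear_combination a * b * c * htu
  simp only [P, xBar_zero, Icc_eq_empty_of_lt zero_lt_one, prod_empty, prod_const_one, mul_one,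
    one_mul, add_zero]
  rw [prod_qInt_sq_sub_eq hq hl.monotoneOn, prod_qFact_sq_eq hq, prod_qInt_sq_staircase_eq hq,
    prod_prod_qInt_sq_pair_eq hq hqInt hle hlc, mul_div_mul_comm, ← zpow_sub₀ hq, hcollect,
    hcollect, hcollect, neg_expE_zero_add_eq_zero hmd x h hle, zpow_zero, mul_one,
    hcancel (prod_symDoubleFact_div hq hqInt (x + (d - m)) m), expF_zero, ← prod_two_pow_div h2 m]
  simp only [symProduct, prod_div_distrib, prod_mul_distrib]
  ring

end Product

end HalvedHexagon

theorem mainTheorem7 {K : Type*} [Field K] (q : K) (h2 : (2 : K) ≠ 0) (hq : q ≠ 0)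
    (hqInt : ∀ k : ℕ, 0 < k → HalvedHexagon.qInt (q ^ 2) k ≠ 0)
    (x d m : ℕ) (hmd : m ≤ d) (l : ℕ → ℕ) (hl : StrictMonoOn l (Set.Icc 1 m))
    (hl_mem : ∀ i ∈ Set.Icc 1 m, l i ∈ Set.Icc 1 d) :
    HalvedHexagon.tgf (HalvedHexagon.wt1 q) (HalvedHexagon.regionA x d m l)
      = HalvedHexagon.P q x 0 d m 0 l (fun _ => 0) := by
  rw [HalvedHexagon.tgf_regionA_wt1 hq h2 hqInt hmd hl hl_mem,
    HalvedHexagon.P_zero_eq_symProduct hq h2 hqInt hmd hl hl_mem]
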